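/- Let $\nu,\widetilde\nu$ be probability measures on $\mathbb R$ with densities $\mathrm{d}\nu=(\text{const.})\,e^{-g(x)}\,\mathrm{d}x$ and $\mathrm{d}\widetilde\nu=(\text{const.})\,e^{-\widetilde g(x)}\,\mathrm{d}x$ ($g,\widetilde g$ real-valued), both with mean zero, $\nu$ having variance $1/2$. Assume that: (i) $g$ is twice differentiable and $\sup_{x\in\mathbb R} g''(x)<\infty$; (ii) $\int e^{\delta x^2}\,\mathrm{d}\widetilde\nu(x)<\infty$ for some $\delta>0$; (iii) $\nu$ satisfies a logarithmic Sobolev inequality: there is a constant $C_{\rm sob}$ such that $\int u\log u\,\mathrm{d}\nu\le C_{\rm sob}\int |\nabla\sqrt u|^2\,\mathrm{d}\nu$ for every continuously differentiable density $u>0$ with $\int u\,\mathrm{d}\nu=1$. For each $N$ let $H=(h_{ij})$ be the $N\times N$ Hermitian random matrix with $h_{ij}=N^{-1/2}(x_{ij}+\sqrt{-1}\,y_{ij})$ for $i<j$, $h_{ii}=N^{-1/2}x_{ii}$ and $h_{ji}=\overline{h_{ij}}$, where all $x_{ij},y_{ij}$ $(i<j)$ and $x_{ii}$ are independent real random variables,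 the $x_{ij},y_{ij}$ $(i<j)$ having law $\nu$ and the $x_{ii}$ having law $\widetilde\nu$. Fix $\kappa>0$. Then there is $C_0>0$ such that for every $C\ge C_0$ there exist $c>0$ and $N_0$, where $C_0,c,N_0$ depend on $\nu,\widetilde\nu,\kappa$ and $c,N_0$ may also depend on $C$, such that for all $N\ge N_0$ $$\mathbb P\Big\{\exists\, \mathbf v\in\mathbb C^N \text{ with } H\mathbf v=\mu\mathbf v,\ \|\mathbf v\|_2=1,\ \mu\in[-2+\kappa,2-\kappa] \text{ and } \|\mathbf v\|_\infty\ge \frac{C(\log N)^{9/2}}{N^{1/2}}\Big\}\le e^{-c(\log N)^2}.$$ -/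

import Mathlib

open MeasureTheory ProbabilityTheory
open scoped Matrix

/-- `ν` is absolutely continuous with strictly positive density `(const.) * exp (-g)`. -/
def HasExpDensity (ν : Measure ℝ) (g : ℝ → ℝ) : Prop :=
  Measurable g ∧ ∃ a : ℝ, 0 < a ∧
    ν = (volume : Measure ℝ).withDensity (fun x => ENNReal.ofReal (a * Real.exp (-g x)))

/-- `g` is twice differentiable and `sup g'' < ∞`. -/
def SecondDerivBddAbove (g : ℝ → ℝ) : Prop :=
  Differentiable ℝ g ∧ Differentiable ℝ (deriv g) ∧
    BddAbove (Set.range (deriv (deriv g)))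

/-- `∫ exp (δ x ^ 2) dν < ∞` for some `δ > 0`. -/
def HasGaussianMoment (ν : Measure ℝ) : Prop :=
  ∃ δ : ℝ, 0 < δ ∧ Integrable (fun x => Real.exp (δ * x ^ 2)) ν

/-- The logarithmic Sobolev inequality `∫ u log u dν ≤ Csob ∫ |∇ √u|² dν` for all (continuously
differentiable) probability densities `u > 0` with respect to `ν`. When the right-hand side is
infinite nothing is claimed; when it is finite, the left-hand side is finite as well. -/
def LogSobolev (ν : Measure ℝ) : Prop :=
  ∃ Csob : ℝ, ∀ u : ℝ → ℝ, ContDiff ℝ 1 u → (∀ x, 0 < u x) →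
    Integrable u ν → ∫ x, u x ∂ν = 1 →
    Integrable (fun x => (deriv (fun y => √(u y)) x) ^ 2) ν →
      Integrable (fun x => u x * Real.log (u x)) ν ∧
      ∫ x, u x * Real.log (u x) ∂ν ≤ Csob * ∫ x, (deriv (fun y => √(u y)) x) ^ 2 ∂ν

/-- Labels of the real random variables of an `N × N` Hermitian Wigner ensemble:
`Sum.inl (i, j)` with `i ≤ j` labels `x_ij`, `Sum.inr (i, j)` with `i < j` labels `y_ij`. -/
abbrev WignerIndex (N : ℕ) : Type :=
  {p : Fin N × Fin N // p.1 ≤ p.2} ⊕ {p : Fin N × Fin N // p.1 < p.2}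

/-- The prescribed law of each variable: `νd` for the diagonal `x_ii`, and `ν` for
`x_ij`, `y_ij` with `i < j`. -/
noncomputable def wignerLaw {N : ℕ} (ν νd : Measure ℝ) : WignerIndex N → Measure ℝ
  | Sum.inl p => if p.1.1 = p.1.2 then νd else ν
  | Sum.inr _ => ν

/-- The variables `x_ij`, `y_ij` (`i < j`) and `x_ii` are independent with the prescribed laws. -/
structure IsWignerFamily {N : ℕ} (ν νd : Measure ℝ) {Ω : Type*} [MeasurableSpace Ω]
    (P : Measure Ω) (X : WignerIndex N → Ω → ℝ) : Prop where
  measurable : ∀ k, Measurable (X k)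
  indep : iIndepFun X P
  law : ∀ k, P.map (X k) = wignerLaw ν νd k

/-- The Hermitian matrix with `h_ij = N^(-1/2) (x_ij + √-1 y_ij)` for `i < j`,
`h_ii = N^(-1/2) x_ii`, and `h_ij = conj h_ji` for `j < i`. -/
noncomputable def wignerMatrix {N : ℕ} (X : WignerIndex N → ℝ) : Matrix (Fin N) (Fin N) ℂ :=
  Matrix.of fun i j =>
    ((1 / √(N : ℝ) : ℝ) : ℂ) *
      (if hij : i < j then
        (X (Sum.inl ⟨(i, j), hij.le⟩) : ℂ) + Complex.I * (X (Sum.inr ⟨(i, j), hij⟩) : ℂ)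
      else if hji : j < i then
        (X (Sum.inl ⟨(j, i), hji.le⟩) : ℂ) - Complex.I * (X (Sum.inr ⟨(j, i), hji⟩) : ℂ)
      else (X (Sum.inl ⟨(i, i), le_refl i⟩) : ℂ))

/-- `H` has an `ℓ²`-normalized eigenvector `v` with eigenvalue in `[-2 + κ, 2 - κ]` and
`‖v‖_∞ ≥ K`. -/
def HasLocalizedBulkEigenvector {N : ℕ} (H : Matrix (Fin N) (Fin N) ℂ) (κ K : ℝ) : Prop :=
  ∃ v : EuclideanSpace ℂ (Fin N), ∃ μ : ℝ,
    H *ᵥ v.ofLp = (μ : ℂ) • v.ofLp ∧ ‖v‖ = 1 ∧ μ ∈ Set.Icc (-2 + κ) (2 - κ) ∧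
      K ≤ ⨆ j : Fin N, ‖v j‖

/-!
# Delocalization of eigenvectors of Hermitian Wigner matrices

Let `G = (H - z)⁻¹` be the resolvent at `z = E + i η`. If `H v = μ v` with `‖v‖ = 1` and
`|μ - E| ≤ η`, then the Ward identity gives `|v j| ^ 2 ≤ 2 η |G j j|`
(`norm_sq_eigenvector_le`). So it suffices to bound the diagonal of `G` by a constant at a scale
`η` of order `(log N) ^ 9 / N`, for `E` in a grid of spacing `1 / N`.

The Schur complement formula reads `G j j * (z + m + Y j) = -1`, where `m` is the normalized trace
of `G` and `Y j` is an error: the fluctuation of the quadratic form of the `j`th column in the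
resolvent of the `j`th minor, plus the entry `H j j`, plus the effect of deleting a row and a
column on the trace. If `|G j j| ≤ 8` for all `j` and all `Y j` are small, then averaging over `j`
shows that `m (z + m)` is close to `-1`. As `z` is bounded, `z + m` cannot be small: otherwise `m`
would be bounded and the product small. Hence `|G j j| = |z + m + Y j|⁻¹ ≤ 4`
(`norm_green_diag_le_four`). The comparison with the semicircle law, and the stability of its
equation, are not needed for this one-sided bound. Halving `η` at most doubles `|G j j|`
(`norm_green_diag_half_le`), so the bound `4` propagates from `η = 1` down the dyadic scales as
long as the errors stay small (`norm_green_dyadic_le_four`).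

The errors are controlled by concentration of quadratic forms. The logarithmic Sobolev inequality
makes `ν` sub-Gaussian by Herbst's argument (`LogSobolev.exists_hasSubgaussianMGF`). Ordering the
variables, the off-diagonal part of a quadratic form is `∑ j, ξ j * L j` with `L j` linear in the
variables preceding `ξ j`; truncating each `L j` at `t` times its standard deviation leaves a
martingale with sub-Gaussian increments (`hasSubgaussianMGF_sum_truncLowerForm`). This gives
deviations of at most `t ^ 2` times the Frobenius norm outside an event of probability
`exp (-b t ^ 2)`, up to a factor linear in the number of variables (`exists_quadForm_tail`). With
`t = log N`, and the Frobenius norm of the resolvent of the minor bounded by `(9 N / η) ^ (1 / 2)`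
through the Ward identity, the error is at most of order `(log N) ^ 2 / (N η) ^ (1 / 2)`, which is
small for `N η ≥ (log N) ^ 9`. The bound on each minor is applied with the minor frozen
(`measure_le_of_forall_frozen`), and a union bound over rows, grid energies and dyadic scales
concludes.
-/

/-! ### Resolvents of Hermitian matrices -/

section Resolvent

variable {n : Type*} [Fintype n] [DecidableEq n]

/-- The resolvent `(H - z)⁻¹`; for Hermitian `H` the matrix `H - z` is invertible as soon as
`z.im > 0`. -/
noncomputable def green (H : Matrix n n ℂ) (z : ℂ) : Matrix n n ℂ := (H - z • 1)⁻¹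

lemma isUnit_det_sub_smul_one {H : Matrix n n ℂ} (hH : H.IsHermitian) {z : ℂ} (hz : 0 < z.im) :
    IsUnit (H - z • (1 : Matrix n n ℂ)).det := by
  rw [isUnit_iff_ne_zero]
  intro h0
  obtain ⟨v, hv, hv0⟩ := Matrix.exists_mulVec_eq_zero_iff.mpr h0
  have h1 : H *ᵥ v = z • v := by
    rw [Matrix.sub_mulVec, Matrix.smul_mulVec, Matrix.one_mulVec, sub_eq_zero] at hv0
    exact hv0
  have h2 : (star v ⬝ᵥ (H *ᵥ v)).im = 0 := hH.im_star_dotProduct_mulVec_self v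
  have h3 : star v ⬝ᵥ v = ((∑ i, ‖v i‖ ^ 2 : ℝ) : ℂ) := by
    simp only [dotProduct, Pi.star_apply, RCLike.star_def, Complex.conj_mul']
    push_cast
    rfl
  rw [h1, dotProduct_smul, h3, smul_eq_mul, Complex.im_mul_ofReal] at h2
  have h4 : ∑ i, ‖v i‖ ^ 2 = 0 := (mul_eq_zero.mp h2).resolve_left hz.ne'
  rw [Finset.sum_eq_zero_iff_of_nonneg (fun i _ => by positivity)] at h4
  exact hv (funext fun i => by simpa using h4 i (Finset.mem_univ i))

variable {H : Matrix n n ℂ} {z : ℂ}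

lemma sub_mul_green (hH : H.IsHermitian) (hz : 0 < z.im) : (H - z • 1) * green H z = 1 :=
  Matrix.mul_nonsing_inv _ (isUnit_det_sub_smul_one hH hz)

lemma green_mul_sub (hH : H.IsHermitian) (hz : 0 < z.im) : green H z * (H - z • 1) = 1 :=
  Matrix.nonsing_inv_mul _ (isUnit_det_sub_smul_one hH hz)

omit [Fintype n] in
lemma conjTranspose_sub_smul_one (hH : H.IsHermitian) :
    (H - z • (1 : Matrix n n ℂ))ᴴ = (H - z • 1) + ((2 * z.im : ℝ) * Complex.I) • 1 := by
  rw [Matrix.conjTranspose_sub, hH.eq, Matrix.conjTranspose_smul, Matrix.conjTranspose_one,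
    sub_add, ← sub_smul]
  congr 2
  apply Complex.ext
  · simp
  · simp; ring

lemma green_sub_conjTranspose (hH : H.IsHermitian) (hz : 0 < z.im) :
    green H z - (green H z)ᴴ
      = ((2 * z.im : ℝ) * Complex.I) • (green H z * (green H z)ᴴ) := by
  set G := green H z
  set A := H - z • (1 : Matrix n n ℂ)
  have h1 : G * A = 1 := green_mul_sub hH hz
  have h2 : Aᴴ * Gᴴ = 1 := by rw [← Matrix.conjTranspose_mul, h1, Matrix.conjTranspose_one]
  have h3 : G * (Aᴴ - A) * Gᴴ = G - Gᴴ := by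
    rw [mul_sub, sub_mul, mul_assoc, h2, h1, mul_one, one_mul]
  rw [← h3, conjTranspose_sub_smul_one hH, add_sub_cancel_left]
  simp

lemma green_sub_conjTranspose' (hH : H.IsHermitian) (hz : 0 < z.im) :
    green H z - (green H z)ᴴ
      = ((2 * z.im : ℝ) * Complex.I) • ((green H z)ᴴ * green H z) := by
  set G := green H z
  set A := H - z • (1 : Matrix n n ℂ)
  have h1 : A * G = 1 := sub_mul_green hH hz
  have h2 : Gᴴ * Aᴴ = 1 := by rw [← Matrix.conjTranspose_mul, h1, Matrix.conjTranspose_one]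
  have h3 : Gᴴ * (Aᴴ - A) * G = G - Gᴴ := by
    rw [mul_sub, sub_mul, mul_assoc _ A, h1, h2, one_mul, mul_one]
  rw [← h3, conjTranspose_sub_smul_one hH, add_sub_cancel_left]
  simp

/-- Ward identity for the rows of the resolvent. -/
lemma sum_norm_sq_green_row (hH : H.IsHermitian) (hz : 0 < z.im) (k : n) :
    ∑ l, ‖green H z k l‖ ^ 2 = (green H z k k).im / z.im := by
  have h := congrArg Complex.im (congrFun (congrFun (green_sub_conjTranspose hH hz) k) k)
  have h' : (green H z * (green H z)ᴴ) k k = ((∑ l, ‖green H z k l‖ ^ 2 : ℝ) : ℂ) := by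
    simp only [Matrix.mul_apply, Matrix.conjTranspose_apply, RCLike.star_def, Complex.mul_conj']
    push_cast
    rfl
  rw [Matrix.smul_apply, h', Matrix.sub_apply, Matrix.conjTranspose_apply] at h
  simp at h
  field_simp
  simp only [← Complex.ofReal_pow, Complex.ofReal_re] at h
  linarith

/-- Ward identity for the columns of the resolvent. -/
lemma sum_norm_sq_green_col (hH : H.IsHermitian) (hz : 0 < z.im) (k : n) :
    ∑ l, ‖green H z l k‖ ^ 2 = (green H z k k).im / z.im := by
  have h := congrArg Complex.im (congrFun (congrFun (green_sub_conjTranspose' hH hz) k) k)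
  have h' : ((green H z)ᴴ * green H z) k k = ((∑ l, ‖green H z l k‖ ^ 2 : ℝ) : ℂ) := by
    simp only [Matrix.mul_apply, Matrix.conjTranspose_apply, RCLike.star_def, Complex.conj_mul']
    push_cast
    rfl
  rw [Matrix.smul_apply, h', Matrix.sub_apply, Matrix.conjTranspose_apply] at h
  simp at h
  field_simp
  simp only [← Complex.ofReal_pow, Complex.ofReal_re] at h
  linarith

lemma sum_norm_sq_green_row_le (hH : H.IsHermitian) (hz : 0 < z.im) (k : n) :
    ∑ l, ‖green H z k l‖ ^ 2 ≤ ‖green H z k k‖ / z.im := by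
  rw [sum_norm_sq_green_row hH hz]
  gcongr
  exact (le_abs_self _).trans (Complex.abs_im_le_norm _)

lemma sum_norm_sq_green_col_le (hH : H.IsHermitian) (hz : 0 < z.im) (k : n) :
    ∑ l, ‖green H z l k‖ ^ 2 ≤ ‖green H z k k‖ / z.im := by
  rw [sum_norm_sq_green_col hH hz]
  gcongr
  exact (le_abs_self _).trans (Complex.abs_im_le_norm _)

lemma norm_green_diag_le (hH : H.IsHermitian) (hz : 0 < z.im) (k : n) :
    ‖green H z k k‖ ≤ 1 / z.im := by
  have h1 : ‖green H z k k‖ ^ 2 ≤ ‖green H z k k‖ / z.im :=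
    (Finset.single_le_sum (f := fun l => ‖green H z k l‖ ^ 2) (fun l _ => by positivity)
      (Finset.mem_univ k)).trans (sum_norm_sq_green_row_le hH hz k)
  rw [le_div_iff₀ hz] at h1 ⊢
  rcases (norm_nonneg (green H z k k)).eq_or_lt with h0 | h0
  · rw [← h0]; norm_num
  · nlinarith

/-- Cauchy--Schwarz for finite complex sums, without conjugation. -/
lemma norm_sum_mul_sq_le {ι : Type*} (s : Finset ι) (f g : ι → ℂ) :
    ‖∑ i ∈ s, f i * g i‖ ^ 2 ≤ (∑ i ∈ s, ‖f i‖ ^ 2) * ∑ i ∈ s, ‖g i‖ ^ 2 := by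
  have h : ‖∑ i ∈ s, f i * g i‖ ≤ ∑ i ∈ s, ‖f i‖ * ‖g i‖ :=
    (norm_sum_le _ _).trans (Finset.sum_le_sum fun i _ => (norm_mul _ _).le)
  calc _ ≤ (∑ i ∈ s, ‖f i‖ * ‖g i‖) ^ 2 := by gcongr
    _ ≤ _ := Finset.sum_mul_sq_le_sq_mul_sq _ _ _

/-- Halving the imaginary part of the spectral parameter at most doubles a diagonal entry. -/
lemma norm_green_diag_half_le (hH : H.IsHermitian) {w : ℂ} (hw : 0 < w.im)
    (hre : w.re = z.re) (him : z.im = 2 * w.im) (k : n) :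
    ‖green H w k k‖ ≤ 2 * ‖green H z k k‖ := by
  have hz : 0 < z.im := by rw [him]; positivity
  have hzw : z - w = w.im * Complex.I := by
    apply Complex.ext <;> simp [hre, him]; ring
  have h1 : green H z - green H w = (z - w) • (green H w * green H z) := by
    have e1 : green H w * ((H - w • 1) - (H - z • 1)) * green H z
        = green H z - green H w := by
      rw [mul_sub, sub_mul, mul_assoc _ (H - z • 1), sub_mul_green hH hz, green_mul_sub hH hw,
        one_mul, mul_one]
    rw [← e1, sub_sub_sub_cancel_left, ← sub_smul]
    simp
  have h2 := congrFun (congrFun h1 k) k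
  rw [Matrix.smul_apply, Matrix.sub_apply, Matrix.mul_apply, hzw, smul_eq_mul] at h2
  set p := ‖green H w k k‖
  set q := ‖green H z k k‖
  set T := ∑ l, green H w k l * green H z l k
  have hT : ‖T‖ ^ 2 ≤ (p / w.im) * (q / (2 * w.im)) := by
    refine (norm_sum_mul_sq_le _ _ _).trans ?_
    have := sum_norm_sq_green_col_le hH hz k
    rw [him] at this
    exact mul_le_mul (sum_norm_sq_green_row_le hH hw k) this
      (Finset.sum_nonneg fun _ _ => by positivity) (by positivity)
  have hpq : p ≤ q + w.im * ‖T‖ := by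
    have : green H w k k = green H z k k - w.im * Complex.I * T := by rw [← h2]; ring
    calc p = ‖green H z k k - w.im * Complex.I * T‖ := by rw [← this]
      _ ≤ q + ‖w.im * Complex.I * T‖ := norm_sub_le _ _
      _ = q + w.im * ‖T‖ := by simp [abs_of_pos hw]
  have hT' : (w.im * ‖T‖) ^ 2 ≤ p * q / 2 := by
    calc (w.im * ‖T‖) ^ 2 = w.im ^ 2 * ‖T‖ ^ 2 := by ring
      _ ≤ w.im ^ 2 * ((p / w.im) * (q / (2 * w.im))) := by gcongr
      _ = p * q / 2 := by field_simp
  have hp : 0 ≤ p := norm_nonneg _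
  have hq : 0 ≤ q := norm_nonneg _
  by_contra! hlt
  have h5 : p - q ≤ w.im * ‖T‖ := by linarith
  have h6 : (p - q) ^ 2 ≤ p * q / 2 := (pow_le_pow_left₀ (by linarith) h5 2).trans hT'
  -- the difference of the two sides factors as `(p - 2 q) (p - q / 2)`
  nlinarith

/-- Entries of eigenvectors are controlled by diagonal entries of the resolvent at any spectral
parameter whose distance to the eigenvalue is comparable to its imaginary part. -/
lemma norm_sq_eigenvector_le (hH : H.IsHermitian) (hz : 0 < z.im) {v : n → ℂ} {μ : ℝ}
    (hv : H *ᵥ v = (μ : ℂ) • v) (hv1 : ∑ i, ‖v i‖ ^ 2 = 1) (hμ : |μ - z.re| ≤ z.im) (k : n) :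
    ‖v k‖ ^ 2 ≤ 2 * z.im * ‖green H z k k‖ := by
  have h1 : (H - z • 1) *ᵥ v = ((μ : ℂ) - z) • v := by
    rw [Matrix.sub_mulVec, hv, Matrix.smul_mulVec, Matrix.one_mulVec, sub_smul]
  have h2 : v = ((μ : ℂ) - z) • green H z *ᵥ v := by
    rw [← Matrix.mulVec_smul, ← h1, Matrix.mulVec_mulVec, green_mul_sub hH hz, Matrix.one_mulVec]
  have h3 : v k = ((μ : ℂ) - z) * ∑ l, green H z k l * v l := congrFun h2 k
  have h4 : ‖(μ : ℂ) - z‖ ^ 2 ≤ 2 * z.im ^ 2 := by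
    rw [← Complex.normSq_eq_norm_sq, Complex.normSq_apply]
    simp only [Complex.sub_re, Complex.ofReal_re, Complex.sub_im, Complex.ofReal_im]
    nlinarith [sq_abs (μ - z.re), abs_nonneg (μ - z.re)]
  calc ‖v k‖ ^ 2 = ‖(μ : ℂ) - z‖ ^ 2 * ‖∑ l, green H z k l * v l‖ ^ 2 := by
        rw [← mul_pow, ← norm_mul, ← h3]
    _ ≤ (2 * z.im ^ 2) * ((‖green H z k k‖ / z.im) * 1) := by
        gcongr
        refine (norm_sum_mul_sq_le _ _ _).trans ?_
        rw [hv1]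
        gcongr
        exact sum_norm_sq_green_row_le hH hz k
    _ = 2 * z.im * ‖green H z k k‖ := by field_simp

/-- The matrix obtained by deleting row and column `j`. -/
def deleteRowCol (H : Matrix n n ℂ) (j : n) : Matrix {k // k ≠ j} {k // k ≠ j} ℂ :=
  H.submatrix Subtype.val Subtype.val

lemma sum_eq_add_sum_ne {M : Type*} [AddCommMonoid M] (f : n → M) (j : n) :
    ∑ k, f k = f j + ∑ k : {k // k ≠ j}, f k := by
  rw [← Finset.add_sum_erase _ _ (Finset.mem_univ j)]
  congr 1
  exact (Finset.sum_subtype _ (by simp) f)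

/-- The quadratic form of the resolvent of the minor in the off-diagonal part of the `j`th
column. -/
noncomputable def greenForm (H : Matrix n n ℂ) (z : ℂ) (j : n) : ℂ :=
  ∑ k : {k // k ≠ j}, ∑ l : {k // k ≠ j}, H j k * green (deleteRowCol H j) z k l * H l j

omit [Fintype n] [DecidableEq n] in
lemma deleteRowCol_isHermitian (hH : H.IsHermitian) (j : n) : (deleteRowCol H j).IsHermitian :=
  hH.submatrix _

/-- Block elimination: the rows `k ≠ j` of the resolvent in terms of its row `j` and of the
resolvent of the minor. -/
lemma green_off_diag (hH : H.IsHermitian) (hz : 0 < z.im) (j : n) (k : {k // k ≠ j}) (l : n) :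
    green H z k l + (∑ i, green (deleteRowCol H j) z k i * H i j) * green H z j l
      = ∑ i : {k // k ≠ j}, green (deleteRowCol H j) z k i * (1 : Matrix n n ℂ) i l := by
  have hR := green_mul_sub (deleteRowCol_isHermitian hH j) hz
  set R := green (deleteRowCol H j) z
  set G := green H z
  have h1 : ∀ i : {k // k ≠ j}, (1 : Matrix n n ℂ) i l
      = H i j * G j l + ∑ m : {k // k ≠ j}, (deleteRowCol H j - z • 1) i m * G m l := by
    intro i
    rw [← sub_mul_green hH hz, Matrix.mul_apply, sum_eq_add_sum_ne _ j]
    congr 1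
    · simp [Matrix.one_apply_ne i.2, G]
    · refine Finset.sum_congr rfl fun m _ => ?_
      simp [deleteRowCol, Matrix.one_apply, Subtype.ext_iff, G]
  have h2 : ∑ i : {k // k ≠ j}, R k i * ∑ m : {k // k ≠ j},
      (deleteRowCol H j - z • 1) i m * G m l = G k l := by
    simp_rw [Finset.mul_sum, ← mul_assoc]
    rw [Finset.sum_comm]
    simp_rw [← Finset.sum_mul, ← Matrix.mul_apply, hR]
    simp [Matrix.one_apply]
  simp_rw [h1, mul_add, Finset.sum_add_distrib, h2, Finset.sum_mul, mul_assoc]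
  ring

lemma green_col (hH : H.IsHermitian) (hz : 0 < z.im) (j : n) (k : {k // k ≠ j}) :
    green H z k j = -(∑ i, green (deleteRowCol H j) z k i * H i j) * green H z j j := by
  have h := green_off_diag hH hz j k j
  have : ∑ i : {k // k ≠ j}, green (deleteRowCol H j) z k i * (1 : Matrix n n ℂ) i j = 0 :=
    Finset.sum_eq_zero fun i _ => by rw [Matrix.one_apply_ne i.2, mul_zero]
  rw [this] at h
  linear_combination h

/-- Schur complement formula for a diagonal entry of the resolvent. -/
lemma green_diag_mul (hH : H.IsHermitian) (hz : 0 < z.im) (j : n) :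
    green H z j j * (H j j - z - greenForm H z j) = 1 := by
  have h := congrFun (congrFun (sub_mul_green hH hz) j) j
  rw [Matrix.mul_apply, sum_eq_add_sum_ne _ j, Matrix.one_apply_eq] at h
  have h2 : ∑ k : {k // k ≠ j}, (H - z • (1 : Matrix n n ℂ)) j k * green H z k j
      = - greenForm H z j * green H z j j := by
    rw [greenForm, ← Finset.sum_neg_distrib, Finset.sum_mul]
    refine Finset.sum_congr rfl fun k _ => ?_
    rw [green_col hH hz, Matrix.sub_apply, Matrix.smul_apply, Matrix.one_apply_ne k.2.symm]
    simp_rw [mul_assoc, ← Finset.mul_sum]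
    simp
    ring
  rw [h2] at h
  simp at h
  linear_combination h

/-- Deleting a row and a column changes the trace of the resolvent by `O(1 / η)`. -/
lemma norm_trace_green_sub_le (hH : H.IsHermitian) (hz : 0 < z.im) (j : n) :
    ‖∑ k, green H z k k - ∑ k, green (deleteRowCol H j) z k k‖ ≤ 1 / z.im := by
  have hG : green H z j j ≠ 0 := left_ne_zero_of_mul_eq_one (green_diag_mul hH hz j)
  have h1 : ∀ k : {k // k ≠ j}, (green H z k k - green (deleteRowCol H j) z k k) * green H z j j
      = green H z k j * green H z j k := by
    intro k
    have h := green_off_diag hH hz j k k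
    have : ∑ i : {k // k ≠ j}, green (deleteRowCol H j) z k i * (1 : Matrix n n ℂ) i k
        = green (deleteRowCol H j) z k k := by
      rw [Finset.sum_eq_single k]
      · simp
      · intro i _ hi
        rw [Matrix.one_apply_ne (fun h => hi (Subtype.ext h)), mul_zero]
      · simp
    rw [this] at h
    rw [green_col hH hz, ← h]
    ring
  have h2 : (∑ k, green H z k k - ∑ k, green (deleteRowCol H j) z k k) * green H z j j
      = ∑ k, green H z k j * green H z j k := by
    rw [sum_eq_add_sum_ne (fun k => green H z k k) j,
      sum_eq_add_sum_ne (fun k => green H z k j * green H z j k) j, add_sub_assoc,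
      ← Finset.sum_sub_distrib, add_mul, Finset.sum_mul]
    simp_rw [h1]
  have h3 : ‖∑ k, green H z k j * green H z j k‖ ^ 2 ≤ (‖green H z j j‖ / z.im) ^ 2 := by
    refine (norm_sum_mul_sq_le _ _ _).trans ?_
    rw [sq]
    exact mul_le_mul (sum_norm_sq_green_col_le hH hz j) (sum_norm_sq_green_row_le hH hz j)
      (Finset.sum_nonneg fun _ _ => by positivity) (by positivity)
  have h4 := (sq_le_sq₀ (norm_nonneg _) (by positivity)).mp h3
  rw [← h2, norm_mul] at h4
  have h5 : 0 < ‖green H z j j‖ := norm_pos_iff.mpr hG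
  refine le_of_mul_le_mul_right (h4.trans (le_of_eq ?_)) h5
  ring

end Resolvent

/-! ### The bootstrap for the diagonal of the resolvent -/

section Bootstrap

variable {n : Type*} [Fintype n] [DecidableEq n] {H : Matrix n n ℂ}

lemma sum_norm_sq_green_le (hH : H.IsHermitian) {z : ℂ} (hz : 0 < z.im) :
    ∑ k, ∑ l, ‖green H z k l‖ ^ 2 ≤ ‖∑ k, green H z k k‖ / z.im := by
  simp_rw [sum_norm_sq_green_row hH hz]
  rw [← Finset.sum_div, ← Complex.im_sum]
  gcongr
  exact (le_abs_self _).trans (Complex.abs_im_le_norm _)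

/-- One step of the bootstrap: if the quadratic forms in the Schur complement formula are close
to normalized traces, a crude bound on the diagonal of the resolvent improves itself. -/
lemma norm_green_diag_le_four [Nonempty n] (hH : H.IsHermitian) {z : ℂ} (hre : |z.re| ≤ 2)
    (hz : 0 < z.im) (hz1 : z.im ≤ 1) (h8 : ∀ j, ‖green H z j j‖ ≤ 8) {θ : ℝ} (hθ0 : 0 ≤ θ)
    (hdiag : ∀ j, ‖H j j‖ ≤ 1 / 2400)
    (hform : ∀ j, ‖greenForm H z j - (∑ k, green (deleteRowCol H j) z k k) / Fintype.card n‖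
      ≤ θ * √(∑ k, ∑ l, ‖green (deleteRowCol H j) z k l‖ ^ 2))
    (hθ : θ * √(9 * Fintype.card n / z.im) ≤ 1 / 2400)
    (hN : 1 / (Fintype.card n * z.im) ≤ 1 / 2400) (j : n) : ‖green H z j j‖ ≤ 4 := by
  set N : ℝ := (Fintype.card n : ℝ) with hNdef
  have hNpos : 0 < N := by rw [hNdef]; exact_mod_cast Fintype.card_pos
  set m : ℂ := (∑ k, green H z k k) / Fintype.card n with hm
  set Y : n → ℂ := fun j => greenForm H z j - H j j - m with hY
  have htr : ‖∑ k, green H z k k‖ ≤ 8 * N := by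
    refine (norm_sum_le _ _).trans ((Finset.sum_le_sum fun k _ => h8 k).trans (le_of_eq ?_))
    simp [hNdef, mul_comm]
  have hηN : 1 / z.im ≤ N / 2400 := by
    rw [div_le_div_iff₀ (by positivity) (by positivity)] at hN ⊢
    nlinarith
  have hYle : ∀ j, ‖Y j‖ ≤ 1 / 800 := by
    intro j
    have hdel := deleteRowCol_isHermitian hH j
    have ht := norm_trace_green_sub_le hH hz j
    set TR := ∑ k, green (deleteRowCol H j) z k k
    have hTR : ‖TR‖ ≤ 9 * N := by
      have := norm_sub_norm_le TR (∑ k, green H z k k)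
      rw [norm_sub_rev] at this
      linarith
    have hF : ∑ k, ∑ l, ‖green (deleteRowCol H j) z k l‖ ^ 2 ≤ 9 * N / z.im :=
      (sum_norm_sq_green_le hdel hz).trans (by gcongr)
    have h1 : ‖greenForm H z j - TR / Fintype.card n‖ ≤ 1 / 2400 :=
      (hform j).trans ((mul_le_mul_of_nonneg_left (Real.sqrt_le_sqrt hF) hθ0).trans hθ)
    have h2 : ‖TR / Fintype.card n - m‖ ≤ 1 / 2400 := by
      rw [hm, ← sub_div, norm_div, Complex.norm_natCast, norm_sub_rev]
      refine le_trans ?_ hN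
      rw [div_le_div_iff₀ hNpos (by positivity)]
      rw [le_div_iff₀ hz] at ht
      nlinarith
    have e : Y j = (greenForm H z j - TR / Fintype.card n) + (TR / Fintype.card n - m)
        - H j j := by rw [hY]; ring
    rw [e]
    have := norm_sub_le ((greenForm H z j - TR / Fintype.card n) + (TR / Fintype.card n - m))
      (H j j)
    have := norm_add_le (greenForm H z j - TR / Fintype.card n) (TR / Fintype.card n - m)
    have := hdiag j
    linarith
  have hself : ∀ j, green H z j j * (z + m + Y j) = -1 := by
    intro j
    have h := green_diag_mul hH hz j
    rw [hY]
    linear_combination -h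
  -- averaging the Schur complement formula over `j` gives the self-consistent equation for `m`
  have havg : m * (z + m) + 1 = -((∑ j, green H z j j * Y j) / Fintype.card n) := by
    have hc : (Fintype.card n : ℂ) ≠ 0 := by exact_mod_cast Fintype.card_ne_zero
    have h1 : ∑ j, green H z j j * (z + m + Y j) = -(Fintype.card n : ℂ) := by
      simp_rw [hself]; simp
    simp_rw [mul_add _ (z + m)] at h1
    rw [Finset.sum_add_distrib, ← Finset.sum_mul] at h1
    rw [hm]
    rw [hm] at h1
    field_simp
    field_simp at h1
    linear_combination h1
  have hsmall : ‖m * (z + m) + 1‖ ≤ 1 / 100 := by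
    rw [havg, norm_neg, norm_div, Complex.norm_natCast, div_le_iff₀ hNpos]
    refine (norm_sum_le _ _).trans ?_
    calc ∑ j, ‖green H z j j * Y j‖ ≤ ∑ j : n, (8 * (1 / 800) : ℝ) := by
          refine Finset.sum_le_sum fun j _ => ?_
          rw [norm_mul]
          exact mul_le_mul (h8 j) (hYle j) (norm_nonneg _) (by norm_num)
      _ = 1 / 100 * N := by simp [hNdef]; ring
  -- if `z + m` were small then `m` would be bounded, and so `m * (z + m)` could not be near `-1`
  have hzm : 3 / 10 ≤ ‖z + m‖ := by
    have hzn : ‖z‖ ≤ 3 := by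
      have := Complex.norm_le_abs_re_add_abs_im z
      rw [abs_of_pos hz] at this
      linarith
    have h1 : ‖m‖ ≤ ‖z + m‖ + 3 := by
      have := norm_sub_le (z + m) z
      rw [add_sub_cancel_left] at this
      linarith
    have h2 : 1 ≤ ‖m‖ * ‖z + m‖ + 1 / 100 := by
      rw [← norm_mul]
      have := norm_sub_le (m * (z + m) + 1) (m * (z + m))
      rw [add_sub_cancel_left, norm_one] at this
      linarith
    by_contra! hlt
    have := norm_nonneg (z + m)
    nlinarith [norm_nonneg m]
  have h1 : ‖z + m + Y j‖ ≥ 1 / 4 := by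
    have := norm_sub_le (z + m + Y j) (Y j)
    rw [add_sub_cancel_right] at this
    linarith [hYle j]
  have h2 : ‖green H z j j‖ * ‖z + m + Y j‖ = 1 := by
    rw [← norm_mul, hself, norm_neg, norm_one]
  nlinarith [norm_nonneg (green H z j j)]

/-- The spectral parameter `E + i 2 ^ (-k)`. -/
noncomputable def dyadicParam (E : ℝ) (k : ℕ) : ℂ := ⟨E, (1 / 2) ^ k⟩

lemma norm_green_dyadic_le_four [Nonempty n] (hH : H.IsHermitian) {E : ℝ} (hE : |E| ≤ 2) {K : ℕ}
    {θ : ℝ} (hθ0 : 0 ≤ θ) (hdiag : ∀ j, ‖H j j‖ ≤ 1 / 2400)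
    (hform : ∀ k ≤ K, ∀ j, ‖greenForm H (dyadicParam E k) j
        - (∑ i, green (deleteRowCol H j) (dyadicParam E k) i i) / Fintype.card n‖
      ≤ θ * √(∑ i, ∑ l, ‖green (deleteRowCol H j) (dyadicParam E k) i l‖ ^ 2))
    (hθ : θ * √(9 * Fintype.card n / (1 / 2) ^ K) ≤ 1 / 2400)
    (hN : 1 / (Fintype.card n * (1 / 2 : ℝ) ^ K) ≤ 1 / 2400) :
    ∀ k ≤ K, ∀ j, ‖green H (dyadicParam E k) j j‖ ≤ 4 := by
  have hNpos : (0 : ℝ) < Fintype.card n := by exact_mod_cast Fintype.card_pos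
  intro k
  induction k with
  | zero =>
    intro _ j
    refine (norm_green_diag_le hH (z := dyadicParam E 0) ?_ j).trans ?_ <;>
      norm_num [dyadicParam]
  | succ k ih =>
    intro hk j
    have hpos : (0 : ℝ) < (1 / 2) ^ (k + 1) := by positivity
    have hle : (1 / 2 : ℝ) ^ K ≤ (1 / 2) ^ (k + 1) :=
      pow_le_pow_of_le_one (by norm_num) (by norm_num) hk
    refine norm_green_diag_le_four hH (z := dyadicParam E (k + 1)) hE hpos
      (pow_le_one₀ (by norm_num) (by norm_num)) (fun i => ?_) hθ0 hdiag
      (hform (k + 1) hk) ?_ ?_ j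
    · refine (norm_green_diag_half_le hH (z := dyadicParam E k)
        (w := dyadicParam E (k + 1)) hpos rfl ?_ i).trans ?_
      · simp only [dyadicParam]; ring
      · linarith [ih (by omega) i]
    · refine le_trans (mul_le_mul_of_nonneg_left (Real.sqrt_le_sqrt ?_) hθ0) hθ
      exact div_le_div_of_nonneg_left (by positivity) (by positivity) hle
    · refine le_trans ?_ hN
      exact div_le_div_of_nonneg_left (by positivity) (by positivity)
        (mul_le_mul_of_nonneg_left hle hNpos.le)

end Bootstrap

/-! ### Herbst's argument -/

section Herbst

variable {ν : Measure ℝ} [IsProbabilityMeasure ν]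

lemma integrable_exp_mul_of_bounded {f : ℝ → ℝ} (hf : Continuous f) {B : ℝ}
    (hB : ∀ x, |f x| ≤ B) (t : ℝ) : Integrable (fun x => Real.exp (t * f x)) ν := by
  refine Integrable.of_bound (C := Real.exp (|t| * B)) (by fun_prop) (ae_of_all _ fun x => ?_)
  rw [Real.norm_eq_abs, Real.abs_exp]
  refine Real.exp_le_exp.mpr ((le_abs_self _).trans ?_)
  rw [abs_mul]
  exact mul_le_mul_of_nonneg_left (hB x) (abs_nonneg t)

/-- The logarithmic Sobolev inequality for the tilted density `exp (t f) / ∫ exp (t f)`, expressed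
through the cumulant generating function. -/
lemma mul_deriv_cgf_sub_cgf_le {c : ℝ}
    (hc : ∀ u : ℝ → ℝ, ContDiff ℝ 1 u → (∀ x, 0 < u x) →
      Integrable u ν → ∫ x, u x ∂ν = 1 →
      Integrable (fun x => (deriv (fun y => √(u y)) x) ^ 2) ν →
      ∫ x, u x * Real.log (u x) ∂ν ≤ c * ∫ x, (deriv (fun y => √(u y)) x) ^ 2 ∂ν)
    (hc0 : 0 ≤ c) {f : ℝ → ℝ} (hf : ContDiff ℝ 1 f) {B : ℝ} (hB : ∀ x, |f x| ≤ B)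
    (hf' : ∀ x, |deriv f x| ≤ 1) (t : ℝ) :
    t * deriv (cgf f ν) t - cgf f ν t ≤ c * t ^ 2 / 4 := by
  have hint := integrable_exp_mul_of_bounded (ν := ν) hf.continuous hB
  have hset : integrableExpSet f ν = Set.univ := Set.eq_univ_of_forall fun t => hint t
  set Z := mgf f ν t with hZ
  have hZpos : 0 < Z := mgf_pos (hint t)
  have hdiff : Differentiable ℝ f := hf.differentiable (by norm_num)
  set u : ℝ → ℝ := fun x => Real.exp (t * f x) / Z with hu
  have hupos : ∀ x, 0 < u x := fun x => by positivity
  have huint : Integrable u ν := (hint t).div_const Z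
  have hu1 : ∫ x, u x ∂ν = 1 := by
    rw [hu, integral_div]
    exact div_self hZpos.ne'
  have hsqrt : ∀ x, deriv (fun y => √(u y)) x = t / 2 * deriv f x * √(u x) := by
    intro x
    have h1 : HasDerivAt u (Real.exp (t * f x) * (t * deriv f x) / Z) x :=
      (((hdiff x).hasDerivAt.const_mul t).exp).div_const Z
    rw [(h1.sqrt (hupos x).ne').deriv]
    have h2 : 0 < √(u x) := Real.sqrt_pos.mpr (hupos x)
    have h3 : √(u x) ^ 2 = u x := Real.sq_sqrt (hupos x).le
    have h4 : Real.exp (t * f x) * (t * deriv f x) / Z = t * deriv f x * √(u x) ^ 2 := by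
      rw [h3, hu]; ring
    rw [h4]
    field_simp
  have hsq : ∀ x, (deriv (fun y => √(u y)) x) ^ 2 ≤ t ^ 2 / 4 * u x := by
    intro x
    rw [hsqrt, mul_pow, Real.sq_sqrt (hupos x).le]
    refine mul_le_mul_of_nonneg_right ?_ (hupos x).le
    have : deriv f x ^ 2 ≤ 1 := by
      rw [← sq_abs]; exact pow_le_one₀ (abs_nonneg _) (hf' x)
    nlinarith [sq_nonneg t]
  have hf'c : Continuous (deriv f) := hf.continuous_deriv (by norm_num)
  have hsqint : Integrable (fun x => (deriv (fun y => √(u y)) x) ^ 2) ν := by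
    refine (huint.const_mul (t ^ 2 / 4)).mono' ?_ (ae_of_all _ fun x => ?_)
    · have hfc := hf.continuous
      simp_rw [hsqrt]
      fun_prop
    · rw [Real.norm_eq_abs, abs_of_nonneg (sq_nonneg _)]
      exact hsq x
  have hmain := hc u (by fun_prop) hupos huint hu1 hsqint
  have hright : ∫ x, (deriv (fun y => √(u y)) x) ^ 2 ∂ν ≤ t ^ 2 / 4 := by
    refine (integral_mono hsqint (huint.const_mul _) hsq).trans (le_of_eq ?_)
    rw [integral_const_mul, hu1, mul_one]
  have hleft : ∫ x, u x * Real.log (u x) ∂ν = t * deriv (cgf f ν) t - cgf f ν t := by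
    rw [deriv_cgf (by simp [hset])]
    have hlog : ∀ x, u x * Real.log (u x)
        = t / Z * (f x * Real.exp (t * f x)) - cgf f ν t * u x := by
      intro x
      rw [show Real.log (u x) = t * f x - Real.log Z from by
        rw [hu, Real.log_div (Real.exp_pos _).ne' hZpos.ne', Real.log_exp], cgf, ← hZ, hu]
      ring
    have hi : Integrable (fun x => f x * Real.exp (t * f x)) ν :=
      (hint t).bdd_mul hf.continuous.aestronglyMeasurable (ae_of_all _ hB)
    simp_rw [hlog]
    rw [integral_sub (hi.const_mul _) (huint.const_mul _), integral_const_mul, integral_const_mul,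
      hu1]
    ring
  rw [hleft] at hmain
  nlinarith

/-- Integration of the differential inequality of Herbst's argument: `cgf t / t - c t / 4` is
antitone on `t > 0` and tends to the mean at `0`. -/
lemma cgf_le_of_mul_deriv_sub_le {c : ℝ} {f : ℝ → ℝ} (hf : Continuous f) {B : ℝ}
    (hB : ∀ x, |f x| ≤ B)
    (h : ∀ t, t * deriv (cgf f ν) t - cgf f ν t ≤ c * t ^ 2 / 4) {t : ℝ} (ht : 0 < t) :
    cgf f ν t ≤ t * ∫ x, f x ∂ν + c * t ^ 2 / 4 := by
  have hint := integrable_exp_mul_of_bounded (ν := ν) hf hB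
  have hset : integrableExpSet f ν = Set.univ := Set.eq_univ_of_forall fun t => hint t
  have hd : ∀ s, HasDerivAt (cgf f ν) (deriv (cgf f ν) s) s := fun s =>
    (analyticAt_cgf (by simp [hset])).differentiableAt.hasDerivAt
  set φ : ℝ → ℝ := fun s => cgf f ν s / s - c * s / 4 with hφ
  have hφd : ∀ s, 0 < s →
      HasDerivAt φ ((deriv (cgf f ν) s * s - cgf f ν s * 1) / s ^ 2 - c * 1 / 4) s := by
    intro s hs
    exact ((hd s).div (hasDerivAt_id s) hs.ne').sub (((hasDerivAt_id s).const_mul c).div_const 4)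
  have hanti : AntitoneOn φ (Set.Ioi 0) := by
    refine antitoneOn_of_deriv_nonpos (convex_Ioi 0)
      (fun s hs => (hφd s hs).continuousAt.continuousWithinAt)
      (fun s hs => (hφd s (by simpa using hs)).differentiableAt.differentiableWithinAt)
      (fun s hs => ?_)
    have hs : 0 < s := by simpa using hs
    rw [(hφd s hs).deriv, sub_nonpos, div_le_iff₀ (by positivity)]
    linarith [h s]
  have hlim : Filter.Tendsto φ (nhdsWithin 0 (Set.Ioi 0)) (nhds (∫ x, f x ∂ν)) := by
    have h0 : deriv (cgf f ν) 0 = ∫ x, f x ∂ν := by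
      rw [deriv_cgf_zero (by simp [hset])]; simp
    have h1 := (hd 0).tendsto_slope_zero_right
    have h2 : Filter.Tendsto (fun s : ℝ => c * s / 4) (nhdsWithin 0 (Set.Ioi 0)) (nhds 0) := by
      have : Continuous fun s : ℝ => c * s / 4 := by fun_prop
      simpa using (this.tendsto 0).mono_left nhdsWithin_le_nhds
    have h3 := h1.sub h2
    rw [h0, sub_zero] at h3
    refine h3.congr fun s => ?_
    simp [hφ, div_eq_inv_mul]
  have hle : φ t ≤ ∫ x, f x ∂ν := by
    refine ge_of_tendsto hlim ?_
    filter_upwards [Ioo_mem_nhdsGT ht] with s hs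
    exact hanti hs.1 ht hs.2.le
  rw [hφ] at hle
  have : cgf f ν t / t ≤ ∫ x, f x ∂ν + c * t / 4 := by linarith
  rw [div_le_iff₀ ht] at this
  linarith

/-- Smooth bounded truncation of the identity. -/
noncomputable def smoothTrunc (n : ℕ) (x : ℝ) : ℝ := (n + 1) * Real.arctan (x / (n + 1))

lemma hasDerivAt_smoothTrunc (n : ℕ) (x : ℝ) :
    HasDerivAt (smoothTrunc n) (1 / (1 + (x / (n + 1)) ^ 2)) x := by
  have hn : (n + 1 : ℝ) ≠ 0 := by positivity
  have h := (((hasDerivAt_id x).div_const (n + 1 : ℝ)).arctan).const_mul (n + 1 : ℝ)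
  refine h.congr_deriv ?_
  simp only [id]
  field_simp

lemma contDiff_smoothTrunc (n : ℕ) : ContDiff ℝ 1 (smoothTrunc n) := by
  exact contDiff_const.mul (Real.contDiff_arctan.comp (contDiff_id.div_const _))

lemma abs_deriv_smoothTrunc_le (n : ℕ) (x : ℝ) : |deriv (smoothTrunc n) x| ≤ 1 := by
  rw [(hasDerivAt_smoothTrunc n x).deriv, abs_of_pos (by positivity)]
  exact div_le_one_of_le₀ (by nlinarith [sq_nonneg (x / (n + 1))]) (by positivity)

lemma abs_smoothTrunc_le (n : ℕ) (x : ℝ) : |smoothTrunc n x| ≤ (n + 1) * (Real.pi / 2) := by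
  have hn : (0 : ℝ) < n + 1 := by positivity
  rw [smoothTrunc, abs_mul, abs_of_pos hn]
  exact mul_le_mul_of_nonneg_left
    (abs_le.mpr ⟨(Real.neg_pi_div_two_lt_arctan _).le, (Real.arctan_lt_pi_div_two _).le⟩) hn.le

lemma abs_smoothTrunc_le_abs (n : ℕ) (x : ℝ) : |smoothTrunc n x| ≤ |x| := by
  have h := Convex.norm_image_sub_le_of_norm_deriv_le (f := smoothTrunc n) (C := 1)
    (s := Set.univ) (x := 0) (y := x)
    (fun y _ => (hasDerivAt_smoothTrunc n y).differentiableAt)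
    (fun y _ => abs_deriv_smoothTrunc_le n y) convex_univ trivial trivial
  simpa [smoothTrunc] using h

lemma tendsto_smoothTrunc (x : ℝ) :
    Filter.Tendsto (fun n => smoothTrunc n x) Filter.atTop (nhds x) := by
  have h1 : HasDerivAt (fun s : ℝ => Real.arctan (x * s)) x 0 := by
    have h := ((hasDerivAt_id (0 : ℝ)).const_mul x).arctan
    exact h.congr_deriv (by simp)
  have h2 := h1.tendsto_slope_zero_right
  have h3 : Filter.Tendsto (fun n : ℕ => 1 / ((n : ℝ) + 1)) Filter.atTop
      (nhdsWithin 0 (Set.Ioi 0)) :=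
    tendsto_nhdsWithin_iff.mpr ⟨tendsto_one_div_add_atTop_nhds_zero_nat,
      Filter.Eventually.of_forall fun n => by simp only [Set.mem_Ioi]; positivity⟩
  refine (h2.comp h3).congr fun n => ?_
  simp [smoothTrunc, div_eq_mul_inv]

/-- Herbst's argument: a centred measure with a logarithmic Sobolev inequality is sub-Gaussian. -/
lemma LogSobolev.exists_hasSubgaussianMGF (h : LogSobolev ν) (hint : Integrable (fun x => x) ν)
    (hmean : ∫ x, x ∂ν = 0) : ∃ c : NNReal, 0 < c ∧ HasSubgaussianMGF (fun x => x) c ν := by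
  obtain ⟨c₀, hc₀⟩ := h
  set c : ℝ := max c₀ 1 with hcdef
  have hcpos : 0 < c := lt_of_lt_of_le one_pos (le_max_right _ _)
  have hc : ∀ u : ℝ → ℝ, ContDiff ℝ 1 u → (∀ x, 0 < u x) →
      Integrable u ν → ∫ x, u x ∂ν = 1 →
      Integrable (fun x => (deriv (fun y => √(u y)) x) ^ 2) ν →
      ∫ x, u x * Real.log (u x) ∂ν ≤ c * ∫ x, (deriv (fun y => √(u y)) x) ^ 2 ∂ν := by
    intro u h1 h2 h3 h4 h5
    exact (hc₀ u h1 h2 h3 h4 h5).2.trans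
      (mul_le_mul_of_nonneg_right (le_max_left _ _) (integral_nonneg fun x => sq_nonneg _))
  have hpos : ∀ (f : ℝ → ℝ), ContDiff ℝ 1 f → (∃ B, ∀ x, |f x| ≤ B) → (∀ x, |deriv f x| ≤ 1) →
      ∀ t, 0 < t → mgf f ν t ≤ Real.exp (t * ∫ x, f x ∂ν + c * t ^ 2 / 4) := by
    rintro f hf ⟨B, hB⟩ hf' t ht
    rw [← exp_cgf (integrable_exp_mul_of_bounded hf.continuous hB t)]
    exact Real.exp_le_exp.mpr (cgf_le_of_mul_deriv_sub_le hf.continuous hB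
      (mul_deriv_cgf_sub_cgf_le hc hcpos.le hf hB hf') ht)
  have hall : ∀ n t, mgf (smoothTrunc n) ν t
      ≤ Real.exp (t * ∫ x, smoothTrunc n x ∂ν + c * t ^ 2 / 4) := by
    intro n t
    rcases lt_trichotomy t 0 with ht | rfl | ht
    · have h1 := hpos (fun x => -smoothTrunc n x) (contDiff_smoothTrunc n).neg
        ⟨_, fun x => by rw [abs_neg]; exact abs_smoothTrunc_le n x⟩
        (fun x => by
          rw [deriv.fun_neg, abs_neg]; exact abs_deriv_smoothTrunc_le n x) (-t) (by linarith)
      rw [integral_neg] at h1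
      simpa [mgf] using h1
    · simp
    · exact hpos _ (contDiff_smoothTrunc n) ⟨_, abs_smoothTrunc_le n⟩ (abs_deriv_smoothTrunc_le n)
        t ht
  have hmeanlim : Filter.Tendsto (fun n => ∫ x, smoothTrunc n x ∂ν) Filter.atTop (nhds 0) := by
    rw [← hmean]
    refine tendsto_integral_of_dominated_convergence (fun x => |x|)
      (fun n => (contDiff_smoothTrunc n).continuous.aestronglyMeasurable) hint.abs
      (fun n => ae_of_all _ (abs_smoothTrunc_le_abs n)) (ae_of_all _ tendsto_smoothTrunc)
  have hfatou : ∀ t, ∫⁻ x, ENNReal.ofReal (Real.exp (t * x)) ∂ν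
      ≤ ENNReal.ofReal (Real.exp (c * t ^ 2 / 4)) := by
    intro t
    have hlim : Filter.Tendsto
        (fun n => ENNReal.ofReal (Real.exp (t * ∫ x, smoothTrunc n x ∂ν + c * t ^ 2 / 4)))
        Filter.atTop (nhds (ENNReal.ofReal (Real.exp (c * t ^ 2 / 4)))) := by
      refine ENNReal.tendsto_ofReal ((Real.continuous_exp.tendsto _).comp ?_)
      simpa using (hmeanlim.const_mul t).add_const (c * t ^ 2 / 4)
    calc ∫⁻ x, ENNReal.ofReal (Real.exp (t * x)) ∂ν
        = ∫⁻ x, Filter.liminf (fun n => ENNReal.ofReal (Real.exp (t * smoothTrunc n x)))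
            Filter.atTop ∂ν := by
          refine lintegral_congr fun x => (Filter.Tendsto.liminf_eq ?_).symm
          exact ENNReal.tendsto_ofReal
            ((Real.continuous_exp.tendsto _).comp ((tendsto_smoothTrunc x).const_mul t))
      _ ≤ Filter.liminf (fun n => ∫⁻ x, ENNReal.ofReal (Real.exp (t * smoothTrunc n x)) ∂ν)
            Filter.atTop := by
          refine lintegral_liminf_le fun n => ?_
          have := (contDiff_smoothTrunc n).continuous
          fun_prop
      _ ≤ Filter.liminf (fun n => ENNReal.ofReal
            (Real.exp (t * ∫ x, smoothTrunc n x ∂ν + c * t ^ 2 / 4))) Filter.atTop := by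
          refine Filter.liminf_le_liminf (Filter.Eventually.of_forall fun n => ?_)
          rw [← ofReal_integral_eq_lintegral_ofReal
            (integrable_exp_mul_of_bounded (contDiff_smoothTrunc n).continuous
              (abs_smoothTrunc_le n) t) (ae_of_all _ fun x => (Real.exp_pos _).le)]
          exact ENNReal.ofReal_le_ofReal (hall n t)
      _ = _ := hlim.liminf_eq
  have hexp : ∀ t, Integrable (fun x => Real.exp (t * x)) ν := fun t =>
    ⟨by fun_prop, by
      rw [hasFiniteIntegral_iff_ofReal (ae_of_all _ fun x => (Real.exp_pos _).le)]
      exact (hfatou t).trans_lt ENNReal.ofReal_lt_top⟩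
  refine ⟨⟨c, hcpos.le⟩, hcpos, hexp, fun t => ?_⟩
  have h1 := hfatou t
  rw [← ofReal_integral_eq_lintegral_ofReal (hexp t) (ae_of_all _ fun x => (Real.exp_pos _).le),
    ENNReal.ofReal_le_ofReal_iff (Real.exp_pos _).le] at h1
  refine h1.trans (Real.exp_le_exp.mpr ?_)
  change c * t ^ 2 / 4 ≤ c * t ^ 2 / 2
  nlinarith [mul_nonneg hcpos.le (sq_nonneg t)]

end Herbst

/-! ### Exponential moments of squares -/

section SquareMoments

lemma HasSubgaussianMGF.lintegral_exp_le {Ω : Type*} [MeasurableSpace Ω] {P : Measure Ω}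
    {Y : Ω → ℝ} {c : NNReal} (h : HasSubgaussianMGF Y c P) (t : ℝ) :
    ∫⁻ ω, ENNReal.ofReal (Real.exp (t * Y ω)) ∂P ≤ ENNReal.ofReal (Real.exp (c * t ^ 2 / 2)) := by
  rw [← ofReal_integral_eq_lintegral_ofReal (h.integrable_exp_mul t)
    (ae_of_all _ fun x => (Real.exp_pos _).le)]
  exact ENNReal.ofReal_le_ofReal (h.mgf_le t)

lemma hasSubgaussianMGF_of_lintegral_exp_le {Ω : Type*} [MeasurableSpace Ω] {P : Measure Ω}
    {Y : Ω → ℝ} {c : NNReal} (hY : AEMeasurable Y P)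
    (h : ∀ t, ∫⁻ ω, ENNReal.ofReal (Real.exp (t * Y ω)) ∂P
      ≤ ENNReal.ofReal (Real.exp (c * t ^ 2 / 2))) : HasSubgaussianMGF Y c P := by
  have hint : ∀ t, Integrable (fun x => Real.exp (t * Y x)) P := fun t =>
    ⟨(Real.measurable_exp.comp_aemeasurable (hY.const_mul t)).aestronglyMeasurable, by
      rw [hasFiniteIntegral_iff_ofReal (ae_of_all _ fun x => (Real.exp_pos _).le)]
      exact (h t).trans_lt ENNReal.ofReal_lt_top⟩
  refine ⟨hint, fun t => ?_⟩
  have h1 := h t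
  rwa [← ofReal_integral_eq_lintegral_ofReal (hint t) (ae_of_all _ fun x => (Real.exp_pos _).le),
    ENNReal.ofReal_le_ofReal_iff (Real.exp_pos _).le] at h1

variable {ν : Measure ℝ} [IsProbabilityMeasure ν]

/-- Gaussian linearization: `exp (v x² / 2)` is the average of `exp (g x)` over a centred Gaussian
variable `g` of variance `v`, so Gaussian moments follow from a sub-Gaussian bound. -/
lemma hasGaussianMoment_of_hasSubgaussianMGF {c : NNReal} (hc : 0 < c)
    (h : HasSubgaussianMGF (fun x => x) c ν) : HasGaussianMoment ν := by
  set v : NNReal := 1 / (2 * c) with hv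
  have hvpos : 0 < v := by positivity
  have hvc : (v : ℝ) = 1 / (2 * c) := by rw [hv]; push_cast; rfl
  have hcR : (0 : ℝ) < c := hc
  have hvR : (0 : ℝ) < v := hvpos
  refine ⟨v / 2, by positivity, by fun_prop, ?_⟩
  rw [hasFiniteIntegral_iff_ofReal (ae_of_all _ fun x => (Real.exp_pos _).le)]
  have h1 : ∀ x : ℝ, ENNReal.ofReal (Real.exp (v / 2 * x ^ 2))
      = ∫⁻ y, ENNReal.ofReal (Real.exp (y * x)) ∂(gaussianReal 0 v) := by
    intro x
    have := congrFun (mgf_fun_id_gaussianReal (μ := 0) (v := v)) x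
    rw [mgf] at this
    simp_rw [mul_comm _ x]
    rw [← ofReal_integral_eq_lintegral_ofReal (integrable_exp_mul_gaussianReal x)
      (ae_of_all _ fun y => (Real.exp_pos _).le), this]
    congr 2
    ring
  calc ∫⁻ x, ENNReal.ofReal (Real.exp (v / 2 * x ^ 2)) ∂ν
      = ∫⁻ y, ∫⁻ x, ENNReal.ofReal (Real.exp (y * x)) ∂ν ∂(gaussianReal 0 v) := by
        simp_rw [h1]
        exact lintegral_lintegral_swap (by fun_prop)
    _ ≤ ∫⁻ y, ENNReal.ofReal (Real.exp (c * y ^ 2 / 2)) ∂(gaussianReal 0 v) :=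
        lintegral_mono fun y => HasSubgaussianMGF.lintegral_exp_le h y
    _ = ∫⁻ y, ENNReal.ofReal ((√(2 * Real.pi * v))⁻¹ * Real.exp (-(c / 2) * y ^ 2)) := by
        rw [gaussianReal_of_var_ne_zero _ hvpos.ne',
          lintegral_withDensity_eq_lintegral_mul _ (measurable_gaussianPDF _ _) (by fun_prop)]
        refine lintegral_congr fun y => ?_
        rw [Pi.mul_apply, gaussianPDF, gaussianPDFReal, ← ENNReal.ofReal_mul (by positivity),
          mul_assoc, ← Real.exp_add, hvc]
        congr 3
        field_simp
        ring
    _ < ⊤ := by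
        have hi : Integrable (fun y : ℝ => (√(2 * Real.pi * v))⁻¹ * Real.exp (-(c / 2) * y ^ 2)) :=
          (integrable_exp_neg_mul_sq (by positivity)).const_mul _
        exact hi.lintegral_lt_top

lemma exp_le_one_add_add_sq_mul_exp_abs (y : ℝ) :
    Real.exp y ≤ 1 + y + y ^ 2 * Real.exp |y| := by
  have h1 : 1 ≤ Real.exp |y| := Real.one_le_exp (abs_nonneg y)
  rcases le_total |y| 1 with h | h
  · have := (abs_le.mp (Real.abs_exp_sub_one_sub_id_le h)).2
    nlinarith [sq_nonneg y]
  · rcases le_total 0 y with hy | hy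
    · rw [abs_of_nonneg hy] at *
      nlinarith [mul_nonneg (show 0 ≤ y ^ 2 - 1 by nlinarith) (Real.exp_pos y).le]
    · have : Real.exp y ≤ 1 := Real.exp_le_one_iff.mpr hy
      rw [abs_of_nonpos hy] at h
      nlinarith

/-- The centred square of a variable with Gaussian moments has a sub-exponential moment generating
function near the origin. -/
lemma exists_mgf_sq_sub_le {v : ℝ} (hg : HasGaussianMoment ν)
    (hsq : Integrable (fun x => x ^ 2) ν) (hv : ∫ x, x ^ 2 ∂ν = v) (hv0 : 0 ≤ v) :
    ∃ s₀ > 0, ∃ K, 0 ≤ K ∧ ∀ s, |s| ≤ s₀ →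
      Integrable (fun x => Real.exp (s * (x ^ 2 - v))) ν ∧
        mgf (fun x => x ^ 2 - v) ν s ≤ Real.exp (K * s ^ 2) := by
  obtain ⟨δ, hδ, hi⟩ := hg
  set s₀ : ℝ := δ / 2 with hs₀
  have hs₀pos : 0 < s₀ := by positivity
  set D : ℝ := 2 / s₀ ^ 2 * Real.exp (δ * v) with hD
  set I : ℝ := ∫ x, Real.exp (δ * x ^ 2) ∂ν with hI
  have hIpos : 0 ≤ I := integral_nonneg fun x => (Real.exp_pos _).le
  have hb : ∀ s, |s| ≤ s₀ → ∀ x : ℝ, Real.exp (s * (x ^ 2 - v))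
      ≤ 1 + s * (x ^ 2 - v) + s ^ 2 * D * Real.exp (δ * x ^ 2) := by
    intro s hs x
    refine (exp_le_one_add_add_sq_mul_exp_abs _).trans (add_le_add le_rfl ?_)
    set w := |x ^ 2 - v| with hw
    have hw0 : 0 ≤ w := abs_nonneg _
    have h1 : w ^ 2 ≤ 2 / s₀ ^ 2 * Real.exp (s₀ * w) := by
      have := Real.quadratic_le_exp_of_nonneg (mul_nonneg hs₀pos.le hw0)
      rw [div_mul_eq_mul_div, le_div_iff₀ (by positivity)]
      nlinarith [mul_nonneg hs₀pos.le hw0]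
    have h2 : |s * (x ^ 2 - v)| ≤ s₀ * w := by
      rw [abs_mul]; exact mul_le_mul_of_nonneg_right hs hw0
    have hwle : w ≤ x ^ 2 + v := by
      rw [hw, abs_le]; constructor <;> nlinarith [sq_nonneg x]
    calc (s * (x ^ 2 - v)) ^ 2 * Real.exp |s * (x ^ 2 - v)|
        ≤ (s ^ 2 * (2 / s₀ ^ 2 * Real.exp (s₀ * w))) * Real.exp (s₀ * w) := by
          rw [mul_pow, ← sq_abs (x ^ 2 - v)]
          gcongr
      _ = s ^ 2 * (2 / s₀ ^ 2) * Real.exp (δ * w) := by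
          have : Real.exp (δ * w) = Real.exp (s₀ * w) * Real.exp (s₀ * w) := by
            rw [← Real.exp_add, hs₀]; ring_nf
          rw [this]; ring
      _ ≤ s ^ 2 * (2 / s₀ ^ 2) * Real.exp (δ * (x ^ 2 + v)) := by gcongr
      _ = s ^ 2 * D * Real.exp (δ * x ^ 2) := by rw [hD, mul_add, Real.exp_add]; ring
  refine ⟨s₀, hs₀pos, D * I, by positivity, fun s hs => ?_⟩
  have hcen : Integrable (fun x : ℝ => x ^ 2 - v) ν := hsq.sub (integrable_const v)
  have hlin : Integrable (fun x : ℝ => 1 + s * (x ^ 2 - v)) ν :=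
    (integrable_const 1).add (hcen.const_mul s)
  have hr := hlin.add (hi.const_mul (s ^ 2 * D))
  have hint : Integrable (fun x => Real.exp (s * (x ^ 2 - v))) ν := by
    refine hr.mono' (by fun_prop) (ae_of_all _ fun x => ?_)
    rw [Real.norm_eq_abs, Real.abs_exp]
    exact hb s hs x
  refine ⟨hint, ?_⟩
  have h1 : mgf (fun x => x ^ 2 - v) ν s ≤ 1 + s ^ 2 * D * I := by
    refine (integral_mono hint hr (hb s hs)).trans (le_of_eq ?_)
    simp only [Pi.add_apply]
    rw [integral_add hlin (hi.const_mul _), integral_add (integrable_const 1)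
      (hcen.const_mul s), integral_const_mul, integral_const_mul,
      integral_sub hsq (integrable_const v), hv]
    simp [hI]
  refine h1.trans ?_
  have := Real.add_one_le_exp (D * I * s ^ 2)
  linarith

end SquareMoments

/-! ### Freezing part of an independent family -/

section Freezing

variable {Ω : Type*} [MeasurableSpace Ω] {P : Measure Ω} [IsProbabilityMeasure P]
  {ι : Type*} [Fintype ι] [DecidableEq ι] {X : ι → Ω → ℝ}

/-- Integrating a function of an independent family amounts to integrating over the coordinates
in `T` with the others frozen, and then over the others. -/
lemma lintegral_eq_lintegral_lintegral_ite (hX : iIndepFun X P) (hm : ∀ i, Measurable (X i))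
    (T : Finset ι) {f : (ι → ℝ) → ENNReal} (hf : Measurable f) :
    ∫⁻ ω, f (fun i => X i ω) ∂P
      = ∫⁻ ω', ∫⁻ ω, f (fun i => if i ∈ T then X i ω else X i ω') ∂P ∂P := by
  set A : Ω → T → ℝ := fun ω i => X i ω
  set B : Ω → (Tᶜ : Finset ι) → ℝ := fun ω i => X i ω
  have hA : Measurable A := measurable_pi_lambda _ fun i => hm i
  have hB : Measurable B := measurable_pi_lambda _ fun i => hm i
  have hAB : IndepFun A B P := hX.indepFun_finset T Tᶜ disjoint_compl_right hm
  set F : (T → ℝ) × ((Tᶜ : Finset ι) → ℝ) → ι → ℝ := fun p i =>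
    if h : i ∈ T then p.1 ⟨i, h⟩ else p.2 ⟨i, Finset.mem_compl.mpr h⟩
  have hF : Measurable F := by
    refine measurable_pi_lambda _ fun i => ?_
    by_cases h : i ∈ T
    · simp only [F, h, dif_pos]
      exact (measurable_pi_apply _).comp measurable_fst
    · simp only [F, h, dif_neg, not_false_iff]
      exact (measurable_pi_apply _).comp measurable_snd
  have hfF : Measurable (fun p => f (F p)) := hf.comp hF
  have hFX : ∀ ω ω', F (A ω, B ω') = fun i => if i ∈ T then X i ω else X i ω' := by
    intro ω ω'
    funext i
    by_cases h : i ∈ T <;> simp [F, A, B, h]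
  have : IsProbabilityMeasure (P.map A) := Measure.isProbabilityMeasure_map hA.aemeasurable
  have : IsProbabilityMeasure (P.map B) := Measure.isProbabilityMeasure_map hB.aemeasurable
  calc ∫⁻ ω, f (fun i => X i ω) ∂P = ∫⁻ ω, f (F (A ω, B ω)) ∂P := by simp [hFX]
    _ = ∫⁻ p, f (F p) ∂(P.map fun ω => (A ω, B ω)) :=
        (lintegral_map hfF (hA.prodMk hB)).symm
    _ = ∫⁻ b, ∫⁻ a, f (F (a, b)) ∂(P.map A) ∂(P.map B) := by
        rw [hAB.map_prod_eq_prod_map_map hA.aemeasurable hB.aemeasurable]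
        exact lintegral_prod_symm' _ hfF
    _ = ∫⁻ ω', ∫⁻ a, f (F (a, B ω')) ∂(P.map A) ∂P :=
        lintegral_map hfF.lintegral_prod_left' hB
    _ = _ := by
        refine lintegral_congr fun ω' => ?_
        have hg : Measurable fun a => f (F (a, B ω')) :=
          hfF.comp (measurable_id.prodMk measurable_const)
        rw [lintegral_map hg hA]
        simp [hFX]

/-- A probability bound that holds for every frozen value of the coordinates outside `T` holds
unconditionally. -/
lemma measure_le_of_forall_frozen (hX : iIndepFun X P) (hm : ∀ i, Measurable (X i))
    (T : Finset ι) {S : Set (ι → ℝ)} (hS : MeasurableSet S) {ε : ENNReal}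
    (h : ∀ y : ι → ℝ, P {ω | (fun i => if i ∈ T then X i ω else y i) ∈ S} ≤ ε) :
    P {ω | (fun i => X i ω) ∈ S} ≤ ε := by
  have hXm : Measurable (fun ω i => X i ω) := measurable_pi_lambda _ hm
  have h1 : P {ω | (fun i => X i ω) ∈ S}
      = ∫⁻ ω, S.indicator (fun _ => (1 : ENNReal)) (fun i => X i ω) ∂P := by
    have hset : MeasurableSet {ω | (fun i => X i ω) ∈ S} := hXm hS
    rw [← lintegral_indicator_one hset]
    exact lintegral_congr fun ω => by simp [Set.indicator]
  rw [h1, lintegral_eq_lintegral_lintegral_ite hX hm T (measurable_const.indicator hS)]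
  calc _ ≤ ∫⁻ _, ε ∂P := by
        refine lintegral_mono fun ω' => ?_
        refine le_trans (le_of_eq ?_) (h fun i => X i ω')
        have hmm : Measurable (fun ω => (fun i => if i ∈ T then X i ω else X i ω')) := by
          refine measurable_pi_lambda _ fun i => ?_
          by_cases h : i ∈ T
          · simpa [h] using hm i
          · simp [h]
        have hset : MeasurableSet {ω | (fun i => if i ∈ T then X i ω else X i ω') ∈ S} := hmm hS
        rw [← lintegral_indicator_one hset]
        exact lintegral_congr fun ω => by simp [Set.indicator]
    _ = ε := by simp

end Freezing

/-! ### Off-diagonal and diagonal parts of quadratic forms -/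

section Chaos

variable {Ω : Type*} [MeasurableSpace Ω] {P : Measure Ω} [IsProbabilityMeasure P]
  {ι : Type*} [Fintype ι] [LinearOrder ι] {ξ : ι → Ω → ℝ} {c : NNReal}

/-- The linear form multiplying `x j` in `∑ j, ∑ i < j, a i j * x i * x j`. -/
def lowerForm (a : ι → ι → ℝ) (j : ι) (x : ι → ℝ) : ℝ :=
  ∑ i ∈ Finset.univ.filter (· < j), a i j * x i

open Classical in
/-- The form `lowerForm a j`, replaced by `0` where it exceeds `τ j`. -/
noncomputable def truncLowerForm (a : ι → ι → ℝ) (τ : ι → ℝ) (j : ι) (x : ι → ℝ) : ℝ :=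
  if |lowerForm a j x| ≤ τ j then lowerForm a j x else 0

lemma measurable_lowerForm (a : ι → ι → ℝ) (j : ι) : Measurable (lowerForm a j) := by
  unfold lowerForm
  fun_prop

lemma measurable_truncLowerForm (a : ι → ι → ℝ) (τ : ι → ℝ) (j : ι) :
    Measurable (truncLowerForm a τ j) :=
  Measurable.ite (measurableSet_le (measurable_lowerForm a j).abs measurable_const)
    (measurable_lowerForm a j) measurable_const

lemma abs_truncLowerForm_le (a : ι → ι → ℝ) {τ : ι → ℝ} (j : ι) (hτ : 0 ≤ τ j) (x : ι → ℝ) :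
    |truncLowerForm a τ j x| ≤ τ j := by
  unfold truncLowerForm
  split_ifs with h
  · exact h
  · simpa using hτ

lemma truncLowerForm_congr (a : ι → ι → ℝ) (τ : ι → ℝ) {j : ι} {x y : ι → ℝ}
    (h : ∀ i < j, x i = y i) : truncLowerForm a τ j x = truncLowerForm a τ j y := by
  have : lowerForm a j x = lowerForm a j y :=
    Finset.sum_congr rfl fun i hi => by rw [h i (by simpa using hi)]
  simp only [truncLowerForm, this]

/-- A martingale whose increments are `ξ j` times a bounded function of the previous variables is
sub-Gaussian. -/
lemma hasSubgaussianMGF_sum_truncLowerForm (hX : iIndepFun ξ P) (hm : ∀ i, Measurable (ξ i))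
    (hsub : ∀ i, HasSubgaussianMGF (ξ i) c P) (a : ι → ι → ℝ) {τ : ι → ℝ} (hτ : ∀ j, 0 ≤ τ j)
    (t : ℝ) (s : Finset ι) :
    ∫⁻ ω, ENNReal.ofReal (Real.exp
        (t * ∑ j ∈ s, ξ j ω * truncLowerForm a τ j (fun i => ξ i ω))) ∂P
      ≤ ENNReal.ofReal (Real.exp (c * (∑ j ∈ s, τ j ^ 2) * t ^ 2 / 2)) := by
  have hT := measurable_truncLowerForm a τ
  induction s using Finset.induction_on_max with
  | empty => simp
  | insert b s hb ih =>
    have hbs : b ∉ s := fun h => lt_irrefl _ (hb b h)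
    set f : (ι → ℝ) → ENNReal := fun x => ENNReal.ofReal (Real.exp
      (t * ∑ j ∈ insert b s, x j * truncLowerForm a τ j x)) with hf
    have hfm : Measurable f := by fun_prop
    calc _ = ∫⁻ ω', ∫⁻ ω, f (fun i => if i ∈ ({b} : Finset ι) then ξ i ω else ξ i ω') ∂P ∂P :=
          lintegral_eq_lintegral_lintegral_ite hX hm {b} hfm
      _ ≤ ∫⁻ ω', ENNReal.ofReal (Real.exp
            (t * ∑ j ∈ s, ξ j ω' * truncLowerForm a τ j (fun i => ξ i ω')))
            * ENNReal.ofReal (Real.exp (c * τ b ^ 2 * t ^ 2 / 2)) ∂P := by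
          refine lintegral_mono fun ω' => ?_
          set T := truncLowerForm a τ b (fun i => ξ i ω') with hTdef
          have h1 : ∀ ω, f (fun i => if i ∈ ({b} : Finset ι) then ξ i ω else ξ i ω')
              = ENNReal.ofReal (Real.exp
                (t * ∑ j ∈ s, ξ j ω' * truncLowerForm a τ j (fun i => ξ i ω')))
                * ENNReal.ofReal (Real.exp ((t * T) * ξ b ω)) := by
            intro ω
            rw [← ENNReal.ofReal_mul (Real.exp_pos _).le, ← Real.exp_add, hf]
            dsimp only
            rw [Finset.sum_insert hbs, hTdef,
              truncLowerForm_congr a τ (j := b) (y := fun i => ξ i ω')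
                (fun i hi => by simp [hi.ne])]
            have h2 : ∀ j ∈ s, (if j ∈ ({b} : Finset ι) then ξ j ω else ξ j ω')
                * truncLowerForm a τ j (fun i => if i ∈ ({b} : Finset ι) then ξ i ω else ξ i ω')
                = ξ j ω' * truncLowerForm a τ j (fun i => ξ i ω') := by
              intro j hj
              rw [truncLowerForm_congr a τ (j := j) (y := fun i => ξ i ω')
                (fun i hi => by simp [(hi.trans (hb j hj)).ne])]
              simp [(hb j hj).ne]
            rw [Finset.sum_congr rfl h2]
            congr 2
            simp
            ring
          simp_rw [h1]
          rw [lintegral_const_mul _ (by have := hm b; fun_prop)]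
          gcongr
          refine (HasSubgaussianMGF.lintegral_exp_le (hsub b) (t * T)).trans ?_
          refine ENNReal.ofReal_le_ofReal (Real.exp_le_exp.mpr ?_)
          have h3 : T ^ 2 ≤ τ b ^ 2 := by
            rw [← sq_abs]
            exact pow_le_pow_left₀ (abs_nonneg _) (abs_truncLowerForm_le a b (hτ b) _) 2
          have h4 : (c : ℝ) * t ^ 2 * T ^ 2 ≤ c * t ^ 2 * τ b ^ 2 :=
            mul_le_mul_of_nonneg_left h3 (by positivity)
          nlinarith
      _ ≤ _ := by
          have hXm : Measurable (fun ω i => ξ i ω) := measurable_pi_lambda _ hm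
          have hTm : ∀ j, Measurable fun ω => truncLowerForm a τ j (fun i => ξ i ω) :=
            fun j => (hT j).comp hXm
          rw [lintegral_mul_const _ (by fun_prop)]
          refine (mul_le_mul_left ih _).trans (le_of_eq ?_)
          rw [← ENNReal.ofReal_mul (Real.exp_pos _).le, ← Real.exp_add, Finset.sum_insert hbs]
          congr 2
          ring

lemma measureReal_lowerForm_gt_le (hX : iIndepFun ξ P)
    (hsub : ∀ i, HasSubgaussianMGF (ξ i) c P) (hc : 0 < c) (a : ι → ι → ℝ) (j : ι) {t : ℝ}
    (ht : 0 ≤ t) :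
    P.real {ω | t * √(∑ i ∈ Finset.univ.filter (· < j), a i j ^ 2)
        < lowerForm a j (fun i => ξ i ω)} ≤ Real.exp (-t ^ 2 / (2 * c)) := by
  set σ := ∑ i ∈ Finset.univ.filter (· < j), a i j ^ 2 with hσ
  have hσ0 : 0 ≤ σ := Finset.sum_nonneg fun i _ => sq_nonneg _
  rcases hσ0.eq_or_lt with h0 | hpos
  · have hz : ∀ i ∈ Finset.univ.filter (· < j), a i j = 0 := by
      have := (Finset.sum_eq_zero_iff_of_nonneg (fun i _ => sq_nonneg (a i j))).mp h0.symm
      exact fun i hi => pow_eq_zero_iff two_ne_zero |>.mp (this i hi)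
    have hl : ∀ ω, lowerForm a j (fun i => ξ i ω) = 0 := fun ω =>
      Finset.sum_eq_zero fun i hi => by rw [hz i hi, zero_mul]
    simp [hl, ← h0, Real.exp_nonneg]
  · have hind : iIndepFun (fun i ω => a i j * ξ i ω) P :=
      hX.comp (fun i x => a i j * x) (fun i => by fun_prop)
    have h1 := (HasSubgaussianMGF.sum_of_iIndepFun hind (s := Finset.univ.filter (· < j))
      (fun i _ => (hsub i).const_mul (a i j))).measure_ge_le
      (ε := t * √σ) (by positivity)
    have h0 : {ω | t * √σ < lowerForm a j (fun i => ξ i ω)}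
        ⊆ {ω | t * √σ ≤ ∑ i ∈ Finset.univ.filter (· < j), a i j * ξ i ω} :=
      fun ω (hω : t * √σ < _) => hω.le
    refine (measureReal_mono h0).trans (h1.trans (le_of_eq ?_))
    congr 1
    have hsum : ((∑ i ∈ Finset.univ.filter (· < j),
        (⟨a i j ^ 2, sq_nonneg (a i j)⟩ * c : NNReal) : NNReal) : ℝ) = σ * c := by
      push_cast
      rw [hσ, Finset.sum_mul]
      rfl
    rw [hsum, mul_pow, Real.sq_sqrt hσ0]
    have : (0 : ℝ) < c := hc
    field_simp

/-- Tail bound for the off-diagonal part of a quadratic form: with high probability all linear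
forms `lowerForm a j` are below their truncation levels, and then the chaos is a martingale with
sub-Gaussian increments. -/
lemma measureReal_offDiag_gt_le (hX : iIndepFun ξ P) (hm : ∀ i, Measurable (ξ i))
    (hsub : ∀ i, HasSubgaussianMGF (ξ i) c P) (hc : 0 < c) (a : ι → ι → ℝ) {F t : ℝ} (hF : 0 < F)
    (ha : ∑ j, ∑ i ∈ Finset.univ.filter (· < j), a i j ^ 2 ≤ F ^ 2) (ht : 0 < t) :
    P.real {ω | t ^ 2 * F < ∑ j, ξ j ω * lowerForm a j (fun i => ξ i ω)}
      ≤ (2 * Fintype.card ι + 1) * Real.exp (-t ^ 2 / (2 * c)) := by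
  have hcR : (0 : ℝ) < c := hc
  set σ : ι → ℝ := fun j => ∑ i ∈ Finset.univ.filter (· < j), a i j ^ 2 with hσ
  have hσ0 : ∀ j, 0 ≤ σ j := fun j => Finset.sum_nonneg fun i _ => sq_nonneg _
  set τ : ι → ℝ := fun j => t * √(σ j) with hτ
  have hτ0 : ∀ j, 0 ≤ τ j := fun j => by positivity
  set S : Ω → ℝ := fun ω => ∑ j, ξ j ω * truncLowerForm a τ j (fun i => ξ i ω) with hS
  set E := Real.exp (-t ^ 2 / (2 * c)) with hE
  have hXm : Measurable (fun ω i => ξ i ω) := measurable_pi_lambda _ hm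
  have hSm : Measurable S := Finset.measurable_sum _ fun j _ =>
    (hm j).mul ((measurable_truncLowerForm a τ j).comp hXm)
  have hsumτ : ∑ j, τ j ^ 2 ≤ t ^ 2 * F ^ 2 := by
    simp_rw [hτ, mul_pow, Real.sq_sqrt (hσ0 _), ← Finset.mul_sum]
    gcongr
  have hSsub : HasSubgaussianMGF S (c * ⟨t ^ 2 * F ^ 2, by positivity⟩) P := by
    refine hasSubgaussianMGF_of_lintegral_exp_le hSm.aemeasurable fun s => ?_
    refine (hasSubgaussianMGF_sum_truncLowerForm hX hm hsub a hτ0 s Finset.univ).trans ?_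
    refine ENNReal.ofReal_le_ofReal (Real.exp_le_exp.mpr ?_)
    change _ ≤ (c * (t ^ 2 * F ^ 2) : ℝ) * s ^ 2 / 2
    gcongr
  have hStail : P.real {ω | t ^ 2 * F ≤ S ω} ≤ E := by
    refine (hSsub.measure_ge_le (by positivity)).trans (le_of_eq ?_)
    rw [hE]
    congr 1
    change -(t ^ 2 * F) ^ 2 / (2 * (c * (t ^ 2 * F ^ 2) : ℝ)) = _
    field_simp
  have hsubset : {ω | t ^ 2 * F < ∑ j, ξ j ω * lowerForm a j (fun i => ξ i ω)}
      ⊆ {ω | t ^ 2 * F ≤ S ω} ∪ ⋃ j, ({ω | τ j < lowerForm a j (fun i => ξ i ω)}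
        ∪ {ω | τ j < lowerForm (fun i k => -a i k) j (fun i => ξ i ω)}) := by
    intro ω hω
    by_cases hall : ∀ j, |lowerForm a j (fun i => ξ i ω)| ≤ τ j
    · left
      have : S ω = ∑ j, ξ j ω * lowerForm a j (fun i => ξ i ω) :=
        Finset.sum_congr rfl fun j _ => by rw [truncLowerForm, if_pos (hall j)]
      simp only [Set.mem_ofPred_eq] at hω ⊢
      rw [this]
      exact hω.le
    · right
      push Not at hall
      obtain ⟨j, hj⟩ := hall
      refine Set.mem_iUnion.mpr ⟨j, ?_⟩
      have hneg : lowerForm (fun i k => -a i k) j (fun i => ξ i ω)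
          = -lowerForm a j (fun i => ξ i ω) := by simp [lowerForm]
      rcases lt_abs.mp hj with h | h
      · exact Or.inl h
      · right
        simpa [hneg] using h
  refine (measureReal_mono hsubset).trans ((measureReal_union_le _ _).trans ?_)
  have h2 : P.real (⋃ j, ({ω | τ j < lowerForm a j (fun i => ξ i ω)}
      ∪ {ω | τ j < lowerForm (fun i k => -a i k) j (fun i => ξ i ω)}))
      ≤ ∑ _j : ι, (E + E) := by
    refine (measureReal_iUnion_fintype_le _).trans (Finset.sum_le_sum fun j _ => ?_)
    refine (measureReal_union_le _ _).trans (add_le_add ?_ ?_)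
    · exact measureReal_lowerForm_gt_le hX hsub hc a j ht.le
    · have := measureReal_lowerForm_gt_le hX hsub hc (fun i k => -a i k) j ht.le
      simpa [hτ, hσ] using this
  refine (add_le_add hStail h2).trans (le_of_eq ?_)
  simp
  ring

omit [LinearOrder ι] in
/-- Chernoff bound for the diagonal part of a quadratic form. -/
lemma measureReal_diag_gt_le (hX : iIndepFun ξ P) (hm : ∀ i, Measurable (ξ i))
    {v s₀ K : ℝ} (hs₀ : 0 < s₀) (hK : 0 ≤ K)
    (hmgf : ∀ i s, |s| ≤ s₀ → Integrable (fun ω => Real.exp (s * (ξ i ω ^ 2 - v))) P ∧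
      mgf (fun ω => ξ i ω ^ 2 - v) P s ≤ Real.exp (K * s ^ 2))
    (d : ι → ℝ) {F t : ℝ} (hF : 0 < F) (hd : ∑ i, d i ^ 2 ≤ F ^ 2) :
    P.real {ω | t ^ 2 * F < ∑ i, d i * (ξ i ω ^ 2 - v)}
      ≤ Real.exp (K * s₀ ^ 2) * Real.exp (-s₀ * t ^ 2) := by
  set Z : ι → Ω → ℝ := fun i ω => d i * (ξ i ω ^ 2 - v) with hZ
  have hZm : ∀ i, Measurable (Z i) := fun i => by have := hm i; fun_prop
  have hZind : iIndepFun Z P := hX.comp (fun i x => d i * (x ^ 2 - v)) (fun i => by fun_prop)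
  have hs : ∀ i, |s₀ / F * d i| ≤ s₀ := by
    intro i
    have h1 : |d i| ≤ F := by
      refine abs_le_of_sq_le_sq ?_ hF.le
      exact (Finset.single_le_sum (f := fun i => d i ^ 2) (fun i _ => sq_nonneg _)
        (Finset.mem_univ i)).trans hd
    rw [abs_mul, abs_of_pos (by positivity), div_mul_eq_mul_div, div_le_iff₀ hF]
    gcongr
  have hZint : ∀ i, Integrable (fun ω => Real.exp (s₀ / F * Z i ω)) P := by
    intro i
    simpa only [hZ, mul_assoc] using (hmgf i _ (hs i)).1
  have hZle : ∀ i, mgf (Z i) P (s₀ / F) ≤ Real.exp (K * (s₀ / F * d i) ^ 2) := by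
    intro i
    have := (hmgf i _ (hs i)).2
    simpa only [hZ, mgf, mul_assoc] using this
  have hint : Integrable (fun ω => Real.exp (s₀ / F * (∑ i, Z i) ω)) P :=
    hZind.integrable_exp_mul_sum hZm fun i _ => hZint i
  have h1 := measure_ge_le_exp_mul_mgf (μ := P) (X := ∑ i, Z i) (t := s₀ / F) (t ^ 2 * F)
    (by positivity) hint
  have h2 : mgf (∑ i, Z i) P (s₀ / F) ≤ Real.exp (K * s₀ ^ 2) := by
    rw [hZind.mgf_sum hZm]
    calc ∏ i, mgf (Z i) P (s₀ / F) ≤ ∏ i, Real.exp (K * (s₀ / F * d i) ^ 2) :=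
          Finset.prod_le_prod (fun i _ => mgf_nonneg) fun i _ => hZle i
      _ = Real.exp (K * (s₀ / F) ^ 2 * ∑ i, d i ^ 2) := by
          rw [← Real.exp_sum, Finset.mul_sum]
          congr 1
          exact Finset.sum_congr rfl fun i _ => by ring
      _ ≤ Real.exp (K * (s₀ / F) ^ 2 * F ^ 2) := by gcongr
      _ = Real.exp (K * s₀ ^ 2) := by congr 1; field_simp
  calc _ ≤ P.real {ω | t ^ 2 * F ≤ (∑ i, Z i) ω} := by
        refine measureReal_mono fun ω hω => ?_
        simp only [Set.mem_ofPred_eq, Finset.sum_apply, hZ] at hω ⊢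
        exact hω.le
    _ ≤ Real.exp (-(s₀ / F) * (t ^ 2 * F)) * Real.exp (K * s₀ ^ 2) :=
        h1.trans (mul_le_mul_of_nonneg_left h2 (Real.exp_pos _).le)
    _ = _ := by
        rw [mul_comm]
        congr 2
        field_simp

end Chaos

/-! ### Concentration of quadratic forms -/

section QuadraticForm

lemma sum_sum_eq_sum_lt_add_sum_diag {ι : Type*} [Fintype ι] [LinearOrder ι] (f : ι → ι → ℝ) :
    ∑ i, ∑ j, f i j
      = ∑ j, ∑ i ∈ Finset.univ.filter (· < j), (f i j + f j i) + ∑ i, f i i := by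
  have h1 : ∀ i, ∑ j, f i j = ∑ j, (if i < j then f i j else 0)
      + ∑ j, (if j < i then f i j else 0) + f i i := by
    intro i
    have h2 : f i i = ∑ j, (if j = i then f i j else 0) := by simp
    rw [h2, ← Finset.sum_add_distrib, ← Finset.sum_add_distrib]
    refine Finset.sum_congr rfl fun j _ => ?_
    rcases lt_trichotomy i j with h | h | h
    · simp [h, h.ne', h.le.not_gt]
    · simp [h]
    · simp [h, h.ne, h.le.not_gt]
  simp_rw [h1, Finset.sum_add_distrib, Finset.sum_filter]
  rw [Finset.sum_comm (f := fun i j => if i < j then f i j else 0)]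

variable {Ω : Type*} [MeasurableSpace Ω] {P : Measure Ω} [IsProbabilityMeasure P]
  {ι : Type*} [Fintype ι] {ξ : ι → Ω → ℝ} {c : NNReal}

lemma measureReal_quadForm_real_gt_le (hX : iIndepFun ξ P) (hm : ∀ i, Measurable (ξ i))
    (hsub : ∀ i, HasSubgaussianMGF (ξ i) c P) (hc : 0 < c)
    {v s₀ K : ℝ} (hs₀ : 0 < s₀) (hK : 0 ≤ K)
    (hmgf : ∀ i s, |s| ≤ s₀ → Integrable (fun ω => Real.exp (s * (ξ i ω ^ 2 - v))) P ∧
      mgf (fun ω => ξ i ω ^ 2 - v) P s ≤ Real.exp (K * s ^ 2))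
    (q : ι → ι → ℝ) {F t : ℝ} (hF : 0 < F) (hq : ∑ i, ∑ j, q i j ^ 2 ≤ F ^ 2) (ht : 0 < t) :
    P.real {ω | 3 * t ^ 2 * F < ∑ i, ∑ j, q i j * ξ i ω * ξ j ω - v * ∑ i, q i i}
      ≤ (2 * Fintype.card ι + 1) * Real.exp (-t ^ 2 / (2 * c))
        + Real.exp (K * s₀ ^ 2) * Real.exp (-s₀ * t ^ 2) := by
  let _ : LinearOrder ι := LinearOrder.lift' (Fintype.equivFin ι) (Fintype.equivFin ι).injective
  have hsplit := sum_sum_eq_sum_lt_add_sum_diag fun i j => q i j ^ 2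
  have hoff : 0 ≤ ∑ j, ∑ i ∈ Finset.univ.filter (· < j), (q i j ^ 2 + q j i ^ 2) :=
    Finset.sum_nonneg fun j _ => Finset.sum_nonneg fun i _ => by positivity
  have hdiag : 0 ≤ ∑ i, q i i ^ 2 := Finset.sum_nonneg fun i _ => sq_nonneg _
  have ha : ∑ j, ∑ i ∈ Finset.univ.filter (· < j), (q i j + q j i) ^ 2 ≤ (2 * F) ^ 2 := by
    have h1 : ∑ j, ∑ i ∈ Finset.univ.filter (· < j), (q i j + q j i) ^ 2
        ≤ 2 * ∑ j, ∑ i ∈ Finset.univ.filter (· < j), (q i j ^ 2 + q j i ^ 2) := by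
      simp_rw [Finset.mul_sum]
      refine Finset.sum_le_sum fun j _ => Finset.sum_le_sum fun i _ => ?_
      nlinarith [sq_nonneg (q i j - q j i)]
    nlinarith
  have hB := measureReal_offDiag_gt_le hX hm hsub hc (fun i j => q i j + q j i)
    (F := 2 * F) (by positivity) ha ht
  have hD := measureReal_diag_gt_le hX hm hs₀ hK hmgf (fun i => q i i) (t := t) hF
    (by linarith)
  refine le_trans ?_ (add_le_add hB hD)
  refine le_trans (measureReal_mono ?_) (measureReal_union_le _ _)
  intro ω (hω : 3 * t ^ 2 * F < _)
  by_contra hcon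
  simp only [Set.mem_union, Set.mem_ofPred_eq, not_or, not_lt] at hcon
  obtain ⟨h1, h2⟩ := hcon
  have h3 : ∑ i, ∑ j, q i j * ξ i ω * ξ j ω - v * ∑ i, q i i
      = ∑ j, ξ j ω * lowerForm (fun i j => q i j + q j i) j (fun i => ξ i ω)
        + ∑ i, q i i * (ξ i ω ^ 2 - v) := by
    rw [sum_sum_eq_sum_lt_add_sum_diag, Finset.mul_sum, add_sub_assoc, ← Finset.sum_sub_distrib]
    congr 1
    · refine Finset.sum_congr rfl fun j _ => ?_
      rw [lowerForm, Finset.mul_sum]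
      exact Finset.sum_congr rfl fun i _ => by ring
    · exact Finset.sum_congr rfl fun i _ => by ring
  rw [h3] at hω
  linarith

/-- Tail bound at scale `F`, the Frobenius norm of `q`, for a complex quadratic form. -/
lemma measureReal_quadForm_gt_le (hX : iIndepFun ξ P) (hm : ∀ i, Measurable (ξ i))
    (hsub : ∀ i, HasSubgaussianMGF (ξ i) c P) (hc : 0 < c)
    {v s₀ K : ℝ} (hs₀ : 0 < s₀) (hK : 0 ≤ K)
    (hmgf : ∀ i s, |s| ≤ s₀ → Integrable (fun ω => Real.exp (s * (ξ i ω ^ 2 - v))) P ∧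
      mgf (fun ω => ξ i ω ^ 2 - v) P s ≤ Real.exp (K * s ^ 2))
    (q : ι → ι → ℂ) {F t : ℝ} (hF0 : 0 ≤ F) (hq : ∑ i, ∑ j, ‖q i j‖ ^ 2 = F ^ 2) (ht : 0 < t) :
    P.real {ω | 6 * t ^ 2 * F < ‖∑ i, ∑ j, q i j * ξ i ω * ξ j ω - v * ∑ i, q i i‖}
      ≤ 4 * ((2 * Fintype.card ι + 1) * Real.exp (-t ^ 2 / (2 * c))
        + Real.exp (K * s₀ ^ 2) * Real.exp (-s₀ * t ^ 2)) := by
  set B := (2 * Fintype.card ι + 1) * Real.exp (-t ^ 2 / (2 * c))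
        + Real.exp (K * s₀ ^ 2) * Real.exp (-s₀ * t ^ 2) with hB
  have hB0 : 0 ≤ B := by positivity
  rcases hF0.eq_or_lt with h0 | hF
  · -- the form vanishes identically
    have hz : ∀ i j, q i j = 0 := by
      rw [← h0, zero_pow two_ne_zero,
        Finset.sum_eq_zero_iff_of_nonneg (fun i _ => Finset.sum_nonneg fun j _ => by positivity)]
        at hq
      intro i j
      have := (Finset.sum_eq_zero_iff_of_nonneg (fun j _ => by positivity)).mp
        (hq i (Finset.mem_univ i)) j (Finset.mem_univ j)
      simpa using this
    simp [hz, ← h0, hB0]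
  have hle : ∀ (r : ι → ι → ℝ), (∀ i j, r i j ^ 2 ≤ ‖q i j‖ ^ 2) →
      P.real {ω | 3 * t ^ 2 * F < ∑ i, ∑ j, r i j * ξ i ω * ξ j ω - v * ∑ i, r i i} ≤ B := by
    intro r hr
    refine measureReal_quadForm_real_gt_le hX hm hsub hc hs₀ hK hmgf r hF ?_ ht
    rw [← hq]
    exact Finset.sum_le_sum fun i _ => Finset.sum_le_sum fun j _ => hr i j
  have hre : ∀ i j, (q i j).re ^ 2 ≤ ‖q i j‖ ^ 2 := fun i j => by
    rw [← sq_abs]; exact pow_le_pow_left₀ (abs_nonneg _) (Complex.abs_re_le_norm _) 2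
  have him : ∀ i j, (q i j).im ^ 2 ≤ ‖q i j‖ ^ 2 := fun i j => by
    rw [← sq_abs]; exact pow_le_pow_left₀ (abs_nonneg _) (Complex.abs_im_le_norm _) 2
  have h1 := hle (fun i j => (q i j).re) hre
  have h2 := hle (fun i j => -(q i j).re) (fun i j => by rw [neg_sq]; exact hre i j)
  have h3 := hle (fun i j => (q i j).im) him
  have h4 := hle (fun i j => -(q i j).im) (fun i j => by rw [neg_sq]; exact him i j)
  have h5 := add_le_add (add_le_add h1 h2) (add_le_add h3 h4)
  refine le_trans ?_ (h5.trans (le_of_eq (by ring)))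
  refine le_trans ?_ (add_le_add (measureReal_union_le _ _) (measureReal_union_le _ _))
  refine le_trans (measureReal_mono ?_) (measureReal_union_le _ _)
  intro ω (hω : 6 * t ^ 2 * F < _)
  set w := ∑ i, ∑ j, q i j * ξ i ω * ξ j ω - v * ∑ i, q i i with hw
  have hwre : w.re = ∑ i, ∑ j, (q i j).re * ξ i ω * ξ j ω - v * ∑ i, (q i i).re := by
    simp [hw, Complex.re_sum, Complex.im_sum]
  have hwim : w.im = ∑ i, ∑ j, (q i j).im * ξ i ω * ξ j ω - v * ∑ i, (q i i).im := by
    simp [hw, Complex.re_sum, Complex.im_sum]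
  have hn := Complex.norm_le_abs_re_add_abs_im w
  simp only [Set.mem_union, Set.mem_ofPred_eq, neg_mul, Finset.sum_neg_distrib, mul_neg,
    sub_neg_eq_add]
  rcases le_total |w.re| |w.im| with h | h
  · have : 3 * t ^ 2 * F < |w.im| := by linarith
    right
    rcases lt_abs.mp this with h' | h'
    · left; rwa [← hwim]
    · right; linarith
  · have : 3 * t ^ 2 * F < |w.re| := by linarith
    left
    rcases lt_abs.mp this with h' | h'
    · left; rwa [← hwre]
    · right; linarith

end QuadraticForm

/-- Concentration of quadratic forms in independent variables whose law satisfies a logarithmic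
Sobolev inequality, with constants depending on the law only. -/
lemma exists_quadForm_tail {ν : Measure ℝ} [IsProbabilityMeasure ν] (hls : LogSobolev ν)
    (hint : Integrable (fun x => x) ν) (hmean : ∫ x, x ∂ν = 0)
    (hsq : Integrable (fun x => x ^ 2) ν) {v : ℝ} (hv : ∫ x, x ^ 2 ∂ν = v) :
    ∃ A > 0, ∃ b > 0, ∀ {Ω : Type*} [MeasurableSpace Ω] {P : Measure Ω} [IsProbabilityMeasure P]
      {ι : Type} [Fintype ι] {ξ : ι → Ω → ℝ}, iIndepFun ξ P → (∀ i, Measurable (ξ i)) →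
      (∀ i, P.map (ξ i) = ν) → ∀ (q : ι → ι → ℂ) {t : ℝ}, 0 < t →
      P.real {ω | 6 * t ^ 2 * √(∑ i, ∑ j, ‖q i j‖ ^ 2)
          < ‖∑ i, ∑ j, q i j * ξ i ω * ξ j ω - v * ∑ i, q i i‖}
        ≤ A * (Fintype.card ι + 1) * Real.exp (-b * t ^ 2) := by
  obtain ⟨c, hc, hsub⟩ := hls.exists_hasSubgaussianMGF hint hmean
  have hv0 : 0 ≤ v := by rw [← hv]; exact integral_nonneg fun x => sq_nonneg x
  obtain ⟨s₀, hs₀, K, hK, hmgf⟩ :=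
    exists_mgf_sq_sub_le (hasGaussianMoment_of_hasSubgaussianMGF hc hsub) hsq hv hv0
  have hcR : (0 : ℝ) < c := hc
  refine ⟨4 * (2 + Real.exp (K * s₀ ^ 2)), by positivity, min (1 / (2 * c)) s₀, by positivity, ?_⟩
  intro Ω _ P _ ι _ ξ hX hm hlaw q t ht
  have hsub' : ∀ i, HasSubgaussianMGF (ξ i) c P := by
    intro i
    have h := hsub
    rw [← hlaw i] at h
    exact HasSubgaussianMGF.of_map (X := fun x => x) (hm i).aemeasurable h
  have hmgf' : ∀ i s, |s| ≤ s₀ → Integrable (fun ω => Real.exp (s * (ξ i ω ^ 2 - v))) P ∧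
      mgf (fun ω => ξ i ω ^ 2 - v) P s ≤ Real.exp (K * s ^ 2) := by
    intro i s hs
    have h := hmgf s hs
    rw [← hlaw i] at h
    refine ⟨h.1.comp_measurable (hm i), le_trans (le_of_eq ?_) h.2⟩
    rw [mgf, mgf, integral_map (hm i).aemeasurable (by fun_prop)]
  have hq0 : 0 ≤ ∑ i, ∑ j, ‖q i j‖ ^ 2 :=
    Finset.sum_nonneg fun i _ => Finset.sum_nonneg fun j _ => by positivity
  refine (measureReal_quadForm_gt_le hX hm hsub' hc hs₀ hK hmgf' q (Real.sqrt_nonneg _)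
    (Real.sq_sqrt hq0).symm ht).trans ?_
  set b := min (1 / (2 * (c : ℝ))) s₀
  have h1 : Real.exp (-t ^ 2 / (2 * c)) ≤ Real.exp (-b * t ^ 2) := by
    refine Real.exp_le_exp.mpr ?_
    have : b * t ^ 2 ≤ 1 / (2 * c) * t ^ 2 :=
      mul_le_mul_of_nonneg_right (min_le_left _ _) (sq_nonneg t)
    calc -t ^ 2 / (2 * c) = -(1 / (2 * c) * t ^ 2) := by ring
      _ ≤ -b * t ^ 2 := by linarith
  have h2 : Real.exp (-s₀ * t ^ 2) ≤ Real.exp (-b * t ^ 2) := by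
    refine Real.exp_le_exp.mpr ?_
    have : b * t ^ 2 ≤ s₀ * t ^ 2 := mul_le_mul_of_nonneg_right (min_le_right _ _) (sq_nonneg t)
    linarith
  set D := Real.exp (K * s₀ ^ 2)
  have hn : (0 : ℝ) ≤ Fintype.card ι := Nat.cast_nonneg _
  calc _ ≤ 4 * ((2 * Fintype.card ι + 1) * Real.exp (-b * t ^ 2)
        + D * Real.exp (-b * t ^ 2)) := by gcongr
    _ = 4 * (2 * Fintype.card ι + 1 + D) * Real.exp (-b * t ^ 2) := by ring
    _ ≤ _ := by
      refine mul_le_mul_of_nonneg_right ?_ (Real.exp_pos _).le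
      have : 0 < D := Real.exp_pos _
      nlinarith

/-! ### Rows and minors of a Wigner matrix -/

section Wigner

variable {N : ℕ}

lemma wignerMatrix_of_lt (x : WignerIndex N → ℝ) {i j : Fin N} (h : i < j) :
    wignerMatrix x i j = ((1 / √(N : ℝ) : ℝ) : ℂ) *
      (x (Sum.inl ⟨(i, j), h.le⟩) + Complex.I * x (Sum.inr ⟨(i, j), h⟩)) := by
  simp [wignerMatrix, h]

lemma wignerMatrix_of_gt (x : WignerIndex N → ℝ) {i j : Fin N} (h : j < i) :
    wignerMatrix x i j = ((1 / √(N : ℝ) : ℝ) : ℂ) *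
      (x (Sum.inl ⟨(j, i), h.le⟩) - Complex.I * x (Sum.inr ⟨(j, i), h⟩)) := by
  simp [wignerMatrix, h, h.le.not_gt]

lemma wignerMatrix_diag (x : WignerIndex N → ℝ) (i : Fin N) :
    wignerMatrix x i i = ((1 / √(N : ℝ) : ℝ) : ℂ) * x (Sum.inl ⟨(i, i), le_refl i⟩) := by
  simp [wignerMatrix]

lemma wignerMatrix_isHermitian (x : WignerIndex N → ℝ) : (wignerMatrix x).IsHermitian := by
  ext i j
  rw [Matrix.conjTranspose_apply]
  rcases lt_trichotomy i j with h | rfl | h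
  · rw [wignerMatrix_of_lt x h, wignerMatrix_of_gt x h]
    simp
  · rw [wignerMatrix_diag]
    simp
  · rw [wignerMatrix_of_lt x h, wignerMatrix_of_gt x h]
    simp [sub_eq_add_neg]

/-- The label of the real (`false`) or imaginary (`true`) part of the matrix entry in row `j` and
column `k ≠ j`. -/
def rowIndex (j : Fin N) (p : {k // k ≠ j} × Bool) : WignerIndex N :=
  if h : j < p.1 then
    if p.2 then Sum.inr ⟨(j, p.1), h⟩ else Sum.inl ⟨(j, p.1), h.le⟩
  else
    if p.2 then Sum.inr ⟨(p.1, j), lt_of_le_of_ne (not_lt.mp h) p.1.2⟩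
    else Sum.inl ⟨(p.1, j), not_lt.mp h⟩

/-- The coefficient of the variable `rowIndex j p` in the entry `(j, p.1)` of `√N H`. -/
noncomputable def rowCoeff (j : Fin N) (p : {k // k ≠ j} × Bool) : ℂ :=
  if p.2 then (if j < p.1 then Complex.I else -Complex.I) else 1

lemma rowIndex_injective (j : Fin N) : Function.Injective (rowIndex j) := by
  rintro ⟨⟨k, hk⟩, b⟩ ⟨⟨l, hl⟩, b'⟩ h
  rcases lt_or_gt_of_ne hk with h1 | h1 <;> rcases lt_or_gt_of_ne hl with h2 | h2 <;>
    cases b <;> cases b' <;>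
    simp_all [rowIndex, h1.le.not_gt, h2.le.not_gt]

lemma norm_rowCoeff (j : Fin N) (p : {k // k ≠ j} × Bool) : ‖rowCoeff j p‖ = 1 := by
  unfold rowCoeff
  split_ifs <;> simp

lemma wignerMatrix_row (x : WignerIndex N → ℝ) (j : Fin N) (k : {k // k ≠ j}) :
    wignerMatrix x j k = ((1 / √(N : ℝ) : ℝ) : ℂ) *
      ∑ b : Bool, rowCoeff j (k, b) * x (rowIndex j (k, b)) := by
  rcases lt_or_gt_of_ne k.2 with h | h
  · rw [wignerMatrix_of_gt x h]
    congr 1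
    simp [rowCoeff, rowIndex, h.le.not_gt]
    ring
  · rw [wignerMatrix_of_lt x h]
    congr 1
    simp [rowCoeff, rowIndex, h]
    ring

lemma wignerMatrix_col (x : WignerIndex N → ℝ) (j : Fin N) (k : {k // k ≠ j}) :
    wignerMatrix x k j = ((1 / √(N : ℝ) : ℝ) : ℂ) *
      ∑ b : Bool, (starRingEnd ℂ) (rowCoeff j (k, b)) * x (rowIndex j (k, b)) := by
  rw [← (wignerMatrix_isHermitian x).apply, wignerMatrix_row]
  simp

/-- The variables in row `j` do not enter the minor obtained by deleting that row. -/
lemma deleteRowCol_wignerMatrix_congr (j : Fin N) {x y : WignerIndex N → ℝ}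
    (h : ∀ p, p ∉ Set.range (rowIndex j) → x p = y p) :
    deleteRowCol (wignerMatrix x) j = deleteRowCol (wignerMatrix y) j := by
  have hl : ∀ (k l : Fin N) (hkl : k ≤ l), k ≠ j → l ≠ j →
      x (Sum.inl ⟨(k, l), hkl⟩) = y (Sum.inl ⟨(k, l), hkl⟩) := by
    intro k l hkl hk hl
    refine h _ ?_
    rintro ⟨⟨m, b⟩, hm⟩
    unfold rowIndex at hm
    split_ifs at hm <;> simp_all
  have hr : ∀ (k l : Fin N) (hkl : k < l), k ≠ j → l ≠ j →
      x (Sum.inr ⟨(k, l), hkl⟩) = y (Sum.inr ⟨(k, l), hkl⟩) := by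
    intro k l hkl hk hl
    refine h _ ?_
    rintro ⟨⟨m, b⟩, hm⟩
    unfold rowIndex at hm
    split_ifs at hm <;> simp_all
  ext ⟨k, hk⟩ ⟨l, hkl⟩
  simp only [deleteRowCol, Matrix.submatrix_apply]
  rcases lt_trichotomy k l with hlt | rfl | hlt
  · rw [wignerMatrix_of_lt x hlt, wignerMatrix_of_lt y hlt, hl k l hlt.le hk hkl,
      hr k l hlt hk hkl]
  · rw [wignerMatrix_diag, wignerMatrix_diag, hl k k le_rfl hk hk]
  · rw [wignerMatrix_of_gt x hlt, wignerMatrix_of_gt y hlt, hl l k hlt.le hkl hk,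
      hr l k hlt hkl hk]

/-- The set of samples for which the quadratic form in the Schur complement formula for row `j`
deviates from its conditional mean by more than `t ^ 2` times its natural size. -/
def formDeviation (N : ℕ) (j : Fin N) (z : ℂ) (t : ℝ) : Set (WignerIndex N → ℝ) :=
  {x | 12 * t ^ 2 / N * √(∑ k, ∑ l, ‖green (deleteRowCol (wignerMatrix x) j) z k l‖ ^ 2)
    < ‖greenForm (wignerMatrix x) z j
        - (∑ k, green (deleteRowCol (wignerMatrix x) j) z k k) / N‖}

lemma measurable_wignerMatrix_apply (i j : Fin N) :
    Measurable fun x : WignerIndex N → ℝ => wignerMatrix x i j := by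
  rcases lt_trichotomy i j with h | rfl | h
  · simp_rw [wignerMatrix_of_lt _ h]; fun_prop
  · simp_rw [wignerMatrix_diag]; fun_prop
  · simp_rw [wignerMatrix_of_gt _ h]; fun_prop

lemma measurable_green_apply {α n : Type*} [MeasurableSpace α] [Fintype n] [DecidableEq n]
    {M : α → Matrix n n ℂ} (hM : ∀ i j, Measurable fun x => M x i j) (z : ℂ) (k l : n) :
    Measurable fun x => green (M x) z k l := by
  have hdet : ∀ {A : α → Matrix n n ℂ}, (∀ i j, Measurable fun x => A x i j) →
      Measurable fun x => (A x).det := by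
    intro A hA
    simp_rw [Matrix.det_apply']
    exact Finset.measurable_sum _ fun σ _ => measurable_const.mul
      (Finset.measurable_prod _ fun i _ => hA _ _)
  have hA : ∀ i j, Measurable fun x => (M x - z • (1 : Matrix n n ℂ)) i j := fun i j =>
    (hM i j).sub measurable_const
  simp_rw [green, Matrix.inv_def, Matrix.smul_apply, smul_eq_mul, Ring.inverse_eq_inv',
    Matrix.adjugate_apply]
  refine (hdet hA).inv.mul (hdet fun i j => ?_)
  simp_rw [Matrix.updateRow_apply]
  by_cases h : i = l
  · simp [h]
  · simpa [h] using hA i j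

lemma measurableSet_formDeviation (j : Fin N) (z : ℂ) (t : ℝ) :
    MeasurableSet (formDeviation N j z t) := by
  have hG : ∀ k l, Measurable fun x : WignerIndex N → ℝ =>
      green (deleteRowCol (wignerMatrix x) j) z k l :=
    measurable_green_apply (M := fun x : WignerIndex N → ℝ => deleteRowCol (wignerMatrix x) j)
      (fun i k => measurable_wignerMatrix_apply i.1 k.1) z
  have hW := measurable_wignerMatrix_apply (N := N)
  unfold formDeviation greenForm
  refine measurableSet_lt ?_ ?_
  · fun_prop
  · fun_prop

lemma greenForm_wignerMatrix (x : WignerIndex N → ℝ) (z : ℂ) (j : Fin N) :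
    greenForm (wignerMatrix x) z j = ∑ p : {k // k ≠ j} × Bool, ∑ r : {k // k ≠ j} × Bool,
      (rowCoeff j p * green (deleteRowCol (wignerMatrix x) j) z p.1 r.1
        * (starRingEnd ℂ) (rowCoeff j r) / N) * x (rowIndex j p) * x (rowIndex j r) := by
  have hs : ((1 / √(N : ℝ) : ℝ) : ℂ) * ((1 / √(N : ℝ) : ℝ) : ℂ) = 1 / N := by
    rw [← Complex.ofReal_mul, div_mul_div_comm, Real.mul_self_sqrt (Nat.cast_nonneg _)]
    simp
  unfold greenForm
  simp_rw [Fintype.sum_prod_type, wignerMatrix_row, wignerMatrix_col]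
  refine Finset.sum_congr rfl fun k _ => ?_
  rw [Finset.sum_comm]
  refine Finset.sum_congr rfl fun l _ => ?_
  rw [show ∀ a S R T : ℂ, a * S * R * (a * T) = a * a * (S * R * T) from fun a S R T => by ring,
    hs]
  simp only [Fintype.sum_bool]
  ring

variable {ν νd : Measure ℝ}

lemma wignerLaw_rowIndex (j : Fin N) (p : {k // k ≠ j} × Bool) :
    wignerLaw ν νd (rowIndex j p) = ν := by
  unfold rowIndex
  split_ifs with h1 h2 h2
  · rfl
  · simp [wignerLaw, h1.ne]
  · rfl
  · simp [wignerLaw, p.1.2]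

/-- With the minor frozen, the quadratic form of row `j` is a quadratic form in independent
variables of law `ν`. -/
lemma measure_formDeviation_le {A b : ℝ} {Ω : Type*} [MeasurableSpace Ω] {P : Measure Ω}
    [IsProbabilityMeasure P]
    (htail : ∀ {ι : Type} [Fintype ι] {ξ : ι → Ω → ℝ}, iIndepFun ξ P → (∀ i, Measurable (ξ i)) →
      (∀ i, P.map (ξ i) = ν) → ∀ (q : ι → ι → ℂ) {t : ℝ}, 0 < t →
      P.real {ω | 6 * t ^ 2 * √(∑ i, ∑ j, ‖q i j‖ ^ 2)
          < ‖∑ i, ∑ j, q i j * ξ i ω * ξ j ω - ((1 / 2 : ℝ) : ℂ) * ∑ i, q i i‖}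
        ≤ A * (Fintype.card ι + 1) * Real.exp (-b * t ^ 2))
    (hA : 0 ≤ A)
    {X : WignerIndex N → Ω → ℝ} (hX : IsWignerFamily ν νd P X) (j : Fin N) (z : ℂ) {t : ℝ}
    (ht : 0 < t) :
    P {ω | (fun p => X p ω) ∈ formDeviation N j z t}
      ≤ ENNReal.ofReal (A * (2 * N + 1) * Real.exp (-b * t ^ 2)) := by
  have hN : 0 < N := j.pos
  have hNR : (0 : ℝ) < N := by exact_mod_cast hN
  refine measure_le_of_forall_frozen hX.indep hX.measurable (Finset.univ.image (rowIndex j))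
    (measurableSet_formDeviation j z t) fun y => ?_
  set R := green (deleteRowCol (wignerMatrix y) j) z with hR
  set q : {k // k ≠ j} × Bool → {k // k ≠ j} × Bool → ℂ := fun p r =>
    rowCoeff j p * R p.1 r.1 * (starRingEnd ℂ) (rowCoeff j r) / N with hq
  have h1 := htail (ξ := fun p => X (rowIndex j p)) (hX.indep.precomp (rowIndex_injective j))
    (fun p => hX.measurable _) (fun p => by rw [hX.law, wignerLaw_rowIndex]) q ht
  have hcard : (Fintype.card ({k // k ≠ j} × Bool) : ℝ) ≤ 2 * N := by
    have : Fintype.card ({k // k ≠ j} × Bool) ≤ 2 * N := by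
      rw [Fintype.card_prod, Fintype.card_bool, mul_comm]
      have := Fintype.card_subtype_le (fun k : Fin N => k ≠ j)
      rw [Fintype.card_fin] at this
      omega
    exact_mod_cast this
  have hnq : ∑ p, ∑ r, ‖q p r‖ ^ 2 = (2 / N) ^ 2 * ∑ k, ∑ l, ‖R k l‖ ^ 2 := by
    simp only [hq, norm_div, norm_mul, norm_rowCoeff, RCLike.norm_conj, Complex.norm_natCast,
      one_mul, mul_one, Fintype.sum_prod_type, Finset.sum_const, Finset.card_univ,
      Fintype.card_bool, nsmul_eq_mul, div_pow, ← Finset.sum_div, ← Finset.mul_sum]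
    push_cast
    ring
  have hdiag : ((1 / 2 : ℝ) : ℂ) * ∑ p, q p p = (∑ k, R k k) / N := by
    have : ∀ p : {k // k ≠ j} × Bool, q p p = R p.1 p.1 / N := by
      intro p
      have h := Complex.mul_conj' (rowCoeff j p)
      rw [norm_rowCoeff] at h
      rw [hq]
      dsimp only
      rw [mul_right_comm, h]
      simp
    simp only [this, Fintype.sum_prod_type, Finset.sum_const, Finset.card_univ,
      Fintype.card_bool, nsmul_eq_mul, ← Finset.mul_sum, ← Finset.sum_div]
    push_cast
    ring
  have hset : {ω | (fun i => if i ∈ Finset.univ.image (rowIndex j) then X i ω else y i)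
        ∈ formDeviation N j z t}
      = {ω | 6 * t ^ 2 * √(∑ p, ∑ r, ‖q p r‖ ^ 2)
          < ‖∑ p, ∑ r, q p r * X (rowIndex j p) ω * X (rowIndex j r) ω
            - ((1 / 2 : ℝ) : ℂ) * ∑ p, q p p‖} := by
    ext ω
    set x : WignerIndex N → ℝ := fun i =>
      if i ∈ Finset.univ.image (rowIndex j) then X i ω else y i with hx
    have hminor : deleteRowCol (wignerMatrix x) j = deleteRowCol (wignerMatrix y) j := by
      refine deleteRowCol_wignerMatrix_congr j fun p hp => ?_
      have : p ∉ Finset.univ.image (rowIndex j) := by simpa using hp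
      simp only [hx, this, if_false]
    have hxr : ∀ p, x (rowIndex j p) = X (rowIndex j p) ω := fun p => by
      simp only [hx, Finset.mem_image_of_mem _ (Finset.mem_univ p), if_true]
    have hsq : √((2 / (N : ℝ)) ^ 2 * ∑ k, ∑ l, ‖R k l‖ ^ 2)
        = 2 / N * √(∑ k, ∑ l, ‖R k l‖ ^ 2) := by
      rw [Real.sqrt_mul (by positivity), Real.sqrt_sq (by positivity)]
    change x ∈ formDeviation N j z t ↔ _
    simp only [Set.mem_ofPred_eq, formDeviation, greenForm_wignerMatrix, hminor, hxr, ← hR,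
      hnq, hdiag, hsq]
    rw [show 6 * t ^ 2 * (2 / (N : ℝ) * √(∑ k, ∑ l, ‖R k l‖ ^ 2))
      = 12 * t ^ 2 / N * √(∑ k, ∑ l, ‖R k l‖ ^ 2) by ring]
  rw [hset, ← ofReal_measureReal]
  refine ENNReal.ofReal_le_ofReal (h1.trans ?_)
  gcongr

end Wigner

/-! ### Delocalization -/

section Delocalization

variable {N : ℕ}

/-- On the event that no row deviates, at any grid energy and dyadic scale, every eigenvector with
eigenvalue in `[-2, 2]` is delocalized. -/
lemma not_hasLocalizedBulkEigenvector {x : WignerIndex N → ℝ} {L κ C : ℝ} (hN : 0 < N)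
    (hκ : 0 < κ) (hC : 5 ≤ C) (hL : 300 ≤ L) (hLN : L ^ 9 ≤ N) (hLs : 2400 * L ≤ √N)
    (hdiag : ∀ i, |x (Sum.inl ⟨(i, i), le_refl i⟩)| ≤ L)
    (hform : ∀ j : Fin N, ∀ i ≤ 4 * N, ∀ k ≤ N,
      x ∉ formDeviation N j (dyadicParam (-2 + i / N) k) L) :
    ¬ HasLocalizedBulkEigenvector (wignerMatrix x) κ (C * L ^ (9 / 2 : ℝ) / √(N : ℝ)) := by
  rintro ⟨v, μ, hv, hv1, ⟨hμ1, hμ2⟩, hsup⟩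
  have hNR : (0 : ℝ) < N := by exact_mod_cast hN
  have : Nonempty (Fin N) := ⟨⟨0, hN⟩⟩
  have hL0 : 0 < L := by linarith
  -- the smallest dyadic scale above `L ^ 9 / N`
  obtain ⟨K, hK1, hK2⟩ := exists_nat_pow_near_of_lt_one (x := L ^ 9 / N) (y := (1 / 2 : ℝ))
    (by positivity) ((div_le_one hNR).mpr hLN) (by norm_num) (by norm_num)
  rw [div_le_iff₀ hNR] at hK2
  have hη : (0 : ℝ) < (1 / 2) ^ K := by positivity
  have hL9 : (2400 : ℝ) ≤ L ^ 9 := by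
    calc (2400 : ℝ) ≤ 300 ^ 9 := by norm_num
      _ ≤ L ^ 9 := by gcongr
  have hKN : K ≤ N := by
    have h1 : (2 : ℝ) ^ K ≤ N := by
      have : (1 / 2 : ℝ) ^ K * 2 ^ K = 1 := by rw [← mul_pow]; norm_num
      have h2 : (0 : ℝ) < 2 ^ K := by positivity
      nlinarith
    have h2 : 2 ^ K ≤ N := by exact_mod_cast h1
    exact Nat.lt_two_pow_self.le.trans h2
  -- the grid energy just below the eigenvalue
  set i := ⌊(μ + 2) * N⌋₊ with hi
  have hμ0 : 0 ≤ (μ + 2) * N := mul_nonneg (by linarith) hNR.le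
  have hi1 : (i : ℝ) ≤ (μ + 2) * N := Nat.floor_le hμ0
  have hi2 : (μ + 2) * N < i + 1 := Nat.lt_floor_add_one _
  have hi4 : i ≤ 4 * N := by
    have : (i : ℝ) ≤ 4 * N := hi1.trans (by gcongr; linarith)
    exact_mod_cast this
  set E : ℝ := -2 + i / N with hE
  have hE2 : |E| ≤ 2 := by
    have h1 : (i : ℝ) / N ≤ 4 := by rw [div_le_iff₀ hNR]; exact_mod_cast hi4
    have h2 : (0 : ℝ) ≤ i / N := by positivity
    rw [abs_le]; constructor <;> linarith
  have hμE : |μ - E| ≤ (1 / 2) ^ K := by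
    have h1 : (i : ℝ) / N ≤ μ + 2 := by rwa [div_le_iff₀ hNR]
    have h2 : μ + 2 < i / N + 1 / N := by rwa [← add_div, lt_div_iff₀ hNR]
    have h3 : 1 / (N : ℝ) ≤ (1 / 2) ^ K := by
      rw [div_le_iff₀ hNR]; linarith
    rw [abs_le]; constructor <;> linarith
  have hH := wignerMatrix_isHermitian x
  have hG := norm_green_dyadic_le_four hH hE2 (K := K) (θ := 12 * L ^ 2 / N) (by positivity)
    (fun j => ?_) (fun k hk j => ?_) ?_ ?_ K le_rfl
  · have hj : ∀ j, ‖v j‖ ≤ 4 * (L ^ (9 / 2 : ℝ) / √(N : ℝ)) := by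
      intro j
      have h1 := norm_sq_eigenvector_le hH (z := dyadicParam E K) hη hv
        (by rw [← EuclideanSpace.norm_sq_eq, hv1, one_pow]) hμE j
      refine abs_le_of_sq_le_sq' ?_ (by positivity) |>.2
      have h2 : (4 * (L ^ (9 / 2 : ℝ) / √(N : ℝ))) ^ 2 = 16 * (L ^ 9 / N) := by
        rw [mul_pow, div_pow, Real.sq_sqrt hNR.le, ← Real.rpow_natCast (L ^ (9 / 2 : ℝ)) 2,
          ← Real.rpow_mul hL0.le, ← Real.rpow_natCast L 9]
        norm_num
      rw [h2]
      refine h1.trans ?_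
      change 2 * (1 / 2 : ℝ) ^ K * _ ≤ _
      calc 2 * (1 / 2 : ℝ) ^ K * ‖green (wignerMatrix x) (dyadicParam E K) j j‖
          ≤ 2 * (1 / 2 : ℝ) ^ K * 4 := by gcongr; exact hG j
        _ = 16 * (1 / 2 : ℝ) ^ (K + 1) := by ring
        _ ≤ _ := by gcongr
    have h3 := hsup.trans (ciSup_le hj)
    have h4 : 0 < L ^ (9 / 2 : ℝ) / √(N : ℝ) := by positivity
    rw [mul_div_assoc] at h3
    nlinarith
  · rw [wignerMatrix_diag, norm_mul, Complex.norm_real, Complex.norm_real, Real.norm_eq_abs,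
      Real.norm_eq_abs, abs_of_nonneg (by positivity), one_div_mul_eq_div,
      div_le_iff₀ (by positivity)]
    linarith [hdiag j]
  · have := hform j i hi4 k (hk.trans hKN)
    simp only [formDeviation, Set.mem_ofPred_eq, not_lt] at this
    simpa only [Fintype.card_fin] using this
  · have h1 : 9 * (Fintype.card (Fin N) : ℝ) / (1 / 2) ^ K ≤ (3 * N / L ^ 4) ^ 2 := by
      rw [Fintype.card_fin, div_pow (3 * (N : ℝ)), div_le_div_iff₀ hη (by positivity)]
      have h2 : L ^ 8 ≤ N * (1 / 2 : ℝ) ^ K := by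
        calc L ^ 8 ≤ L ^ 9 := pow_le_pow_right₀ (by linarith) (by norm_num)
          _ ≤ _ := by linarith
      calc 9 * (N : ℝ) * (L ^ 4) ^ 2 = 9 * N * L ^ 8 := by ring
        _ ≤ 9 * N * (N * (1 / 2 : ℝ) ^ K) := by gcongr
        _ = _ := by ring
    have h3 : √(9 * (Fintype.card (Fin N) : ℝ) / (1 / 2) ^ K) ≤ 3 * N / L ^ 4 :=
      Real.sqrt_le_iff.mpr ⟨by positivity, h1⟩
    calc _ ≤ 12 * L ^ 2 / N * (3 * N / L ^ 4) := by gcongr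
      _ = 36 / L ^ 2 := by field_simp; norm_num
      _ ≤ 36 / 300 ^ 2 := by gcongr
      _ ≤ _ := by norm_num
  · rw [Fintype.card_fin]
    refine one_div_le_one_div_of_le (by norm_num) ?_
    linarith

/-- Markov's inequality for a diagonal entry. -/
lemma measure_diag_gt_le {νd : Measure ℝ} {δ : ℝ} (hδ : 0 < δ)
    (hi : Integrable (fun x => Real.exp (δ * x ^ 2)) νd) {Ω : Type*} [MeasurableSpace Ω]
    {P : Measure Ω} {Y : Ω → ℝ} (hY : Measurable Y) (hlaw : P.map Y = νd) {t : ℝ} (ht : 0 ≤ t) :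
    P {ω | t < |Y ω|}
      ≤ ENNReal.ofReal ((∫ x, Real.exp (δ * x ^ 2) ∂νd) * Real.exp (-δ * t ^ 2)) := by
  have h1 := mul_meas_ge_le_lintegral₀ (μ := νd)
    (f := fun x => ENNReal.ofReal (Real.exp (δ * x ^ 2))) (by fun_prop)
    (ENNReal.ofReal (Real.exp (δ * t ^ 2)))
  rw [← ofReal_integral_eq_lintegral_ofReal hi (ae_of_all _ fun x => (Real.exp_pos _).le)] at h1
  have hms : MeasurableSet {x : ℝ | t < |x|} := measurableSet_lt (by fun_prop) (by fun_prop)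
  have h2 : P {ω | t < |Y ω|} = νd {x | t < |x|} := by
    rw [← hlaw, Measure.map_apply hY hms]; rfl
  have h3 : νd {x | t < |x|}
      ≤ νd {x | ENNReal.ofReal (Real.exp (δ * t ^ 2)) ≤ ENNReal.ofReal (Real.exp (δ * x ^ 2))} := by
    refine measure_mono fun x (hx : t < |x|) => ?_
    refine ENNReal.ofReal_le_ofReal (Real.exp_le_exp.mpr ?_)
    rw [← sq_abs x]
    gcongr
  rw [h2, ENNReal.ofReal_mul (integral_nonneg fun x => (Real.exp_pos _).le), neg_mul, Real.exp_neg,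
    ENNReal.ofReal_inv_of_pos (Real.exp_pos _), ← div_eq_mul_inv, ENNReal.le_div_iff_mul_le
    (Or.inl (by simpa using Real.exp_pos _)) (Or.inl ENNReal.ofReal_ne_top), mul_comm]
  exact (mul_le_mul_right h3 _).trans h1

/-- Conditions on `N` under which the union bound and the bootstrap apply hold for all large
`N`. -/
lemma eventually_log_conditions (B b : ℝ) (hb : 0 < b) :
    ∀ᶠ N : ℕ in Filter.atTop, 0 < N ∧ 300 ≤ Real.log N ∧ Real.log N ^ 9 ≤ N ∧
      2400 * Real.log N ≤ √(N : ℝ) ∧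
      B * (N : ℝ) ^ 5 * Real.exp (-b * Real.log N ^ 2)
        ≤ Real.exp (-(b / 2) * Real.log N ^ 2) := by
  have hcast : Filter.Tendsto (fun N : ℕ => (N : ℝ)) Filter.atTop Filter.atTop :=
    tendsto_natCast_atTop_atTop
  have hlog : Filter.Tendsto (fun N : ℕ => Real.log N) Filter.atTop Filter.atTop :=
    Real.tendsto_log_atTop.comp hcast
  have h9 : ∀ᶠ N : ℕ in Filter.atTop, Real.log N ^ 9 ≤ N := by
    have := ((Real.isLittleO_pow_log_id_atTop (n := 9)).comp_tendsto hcast).bound (zero_lt_one)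
    filter_upwards [this] with N hN
    simp only [Function.comp, id, Real.norm_eq_abs, one_mul, Nat.abs_cast] at hN
    exact (le_abs_self _).trans hN
  have h2 : ∀ᶠ N : ℕ in Filter.atTop, (2400 * Real.log N) ^ 2 ≤ N := by
    have := ((Real.isLittleO_pow_log_id_atTop (n := 2)).comp_tendsto hcast).bound
      (show (0 : ℝ) < 1 / 2400 ^ 2 by norm_num)
    filter_upwards [this] with N hN
    simp only [Function.comp, id, Real.norm_eq_abs, Nat.abs_cast] at hN
    have := (le_abs_self _).trans hN
    rw [mul_pow]
    linarith
  filter_upwards [Filter.eventually_gt_atTop 0, hlog.eventually_ge_atTop 300, h9, h2,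
    hlog.eventually_ge_atTop (12 / b), hlog.eventually_ge_atTop B] with N h0 h300 h9 h2 hb' hB
  refine ⟨h0, h300, h9, Real.le_sqrt_of_sq_le h2, ?_⟩
  have hN : (0 : ℝ) < N := by exact_mod_cast h0
  set L := Real.log N with hL
  have hNL : (N : ℝ) = Real.exp L := (Real.exp_log hN).symm
  have hBL : B ≤ Real.exp L := hB.trans (by linarith [Real.add_one_le_exp L])
  rw [div_le_iff₀ hb] at hb'
  calc B * (N : ℝ) ^ 5 * Real.exp (-b * L ^ 2)
      ≤ Real.exp L * Real.exp L ^ 5 * Real.exp (-b * L ^ 2) := by rw [hNL]; gcongr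
    _ = Real.exp (6 * L + -b * L ^ 2) := by
        rw [← pow_succ', ← Real.exp_nat_mul, Real.exp_add]; norm_num
    _ ≤ _ := by
        refine Real.exp_le_exp.mpr ?_
        nlinarith

end Delocalization

theorem theorem1p2 (ν νd : Measure ℝ) [IsProbabilityMeasure ν] [IsProbabilityMeasure νd]
    (g gd : ℝ → ℝ)
    (hν : HasExpDensity ν g) (hνd : HasExpDensity νd gd)
    (hν_int : Integrable (fun x => x) ν) (hν_mean : ∫ x, x ∂ν = 0)
    (hν_sq : Integrable (fun x => x ^ 2) ν) (hν_var : ∫ x, x ^ 2 ∂ν = 1 / 2)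
    (hνd_int : Integrable (fun x => x) νd) (hνd_mean : ∫ x, x ∂νd = 0)
    (hC1 : SecondDerivBddAbove g) (hC2 : HasGaussianMoment νd) (hC4 : LogSobolev ν)
    (κ : ℝ) (hκ : 0 < κ) :
    ∃ C₀ : ℝ, 0 < C₀ ∧ ∀ C : ℝ, C₀ ≤ C → ∃ c : ℝ, 0 < c ∧ ∃ N₀ : ℕ, ∀ N : ℕ, N₀ ≤ N →
      ∀ (Ω : Type*) [MeasurableSpace Ω] (P : Measure Ω) [IsProbabilityMeasure P]
        (X : WignerIndex N → Ω → ℝ), IsWignerFamily ν νd P X →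
          P {ω | HasLocalizedBulkEigenvector (wignerMatrix (fun k => X k ω)) κ
              (C * Real.log N ^ (9 / 2 : ℝ) / √(N : ℝ))}
            ≤ ENNReal.ofReal (Real.exp (-c * Real.log N ^ 2)) := by
  obtain ⟨A, hA, b₁, hb₁, htail⟩ := exists_quadForm_tail hC4 hν_int hν_mean hν_sq hν_var
  obtain ⟨δ, hδ, hδi⟩ := hC2
  set M : ℝ := ∫ x, Real.exp (δ * x ^ 2) ∂νd with hM
  have hM0 : 0 ≤ M := integral_nonneg fun x => (Real.exp_pos _).le
  set b := min b₁ δ with hb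
  have hbpos : 0 < b := lt_min hb₁ hδ
  obtain ⟨N₀, hN₀⟩ := Filter.eventually_atTop.mp (eventually_log_conditions (M + 30 * A) b hbpos)
  refine ⟨5, by norm_num, fun C hC => ⟨b / 2, by positivity, N₀, fun N hN Ω _ P _ X hX => ?_⟩⟩
  obtain ⟨hNpos, h300, h9, hs, hunion⟩ := hN₀ N hN
  set L := Real.log N with hL
  have hL0 : 0 < L := by linarith
  have hN1 : (1 : ℝ) ≤ N := by exact_mod_cast hNpos
  set e := Real.exp (-b * L ^ 2) with he
  have hsubset : {ω | HasLocalizedBulkEigenvector (wignerMatrix (fun k => X k ω)) κ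
        (C * L ^ (9 / 2 : ℝ) / √(N : ℝ))}
      ⊆ (⋃ i : Fin N, {ω | L < |X (Sum.inl ⟨(i, i), le_refl i⟩) ω|}) ∪
        ⋃ j : Fin N, ⋃ i : Fin (4 * N + 1), ⋃ k : Fin (N + 1),
          {ω | (fun p => X p ω) ∈ formDeviation N j (dyadicParam (-2 + (i : ℕ) / N) k) L} := by
    intro ω hω
    by_contra hcon
    simp only [Set.mem_union, Set.mem_iUnion, Set.mem_ofPred_eq, not_or, not_exists,
      not_lt] at hcon
    refine not_hasLocalizedBulkEigenvector hNpos hκ hC h300 h9 hs hcon.1 ?_ hω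
    intro j i hi k hk
    exact hcon.2 j ⟨i, by omega⟩ ⟨k, by omega⟩
  have hdiag : ∀ i : Fin N, P {ω | L < |X (Sum.inl ⟨(i, i), le_refl i⟩) ω|}
      ≤ ENNReal.ofReal (M * e) := by
    intro i
    have hlaw := hX.law (Sum.inl ⟨(i, i), le_refl i⟩)
    simp only [wignerLaw, if_true] at hlaw
    refine (measure_diag_gt_le hδ hδi (hX.measurable _) hlaw hL0.le).trans ?_
    refine ENNReal.ofReal_le_ofReal (mul_le_mul_of_nonneg_left (Real.exp_le_exp.mpr ?_) hM0)
    have : b * L ^ 2 ≤ δ * L ^ 2 := mul_le_mul_of_nonneg_right (min_le_right _ _) (sq_nonneg L)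
    linarith
  have hrow : ∀ (j : Fin N) (i : Fin (4 * N + 1)) (k : Fin (N + 1)),
      P {ω | (fun p => X p ω) ∈ formDeviation N j (dyadicParam (-2 + (i : ℕ) / N) k) L}
        ≤ ENNReal.ofReal (A * (2 * N + 1) * e) := by
    intro j i k
    refine (measure_formDeviation_le (fun h1 h2 h3 q t ht => htail h1 h2 h3 q ht) hA.le hX j _
      hL0).trans ?_
    refine ENNReal.ofReal_le_ofReal
      (mul_le_mul_of_nonneg_left (Real.exp_le_exp.mpr ?_) (by positivity))
    have : b * L ^ 2 ≤ b₁ * L ^ 2 := mul_le_mul_of_nonneg_right (min_le_left _ _) (sq_nonneg L)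
    linarith
  refine (measure_mono hsubset).trans ((measure_union_le _ _).trans ?_)
  have h1 : P (⋃ i : Fin N, {ω | L < |X (Sum.inl ⟨(i, i), le_refl i⟩) ω|})
      ≤ ENNReal.ofReal (N * (M * e)) := by
    refine (measure_iUnion_fintype_le _ _).trans ((Finset.sum_le_sum fun i _ => hdiag i).trans ?_)
    rw [Finset.sum_const, Finset.card_univ, Fintype.card_fin, nsmul_eq_mul,
      ENNReal.ofReal_mul (Nat.cast_nonneg _), ENNReal.ofReal_natCast]
  have h2 : P (⋃ j : Fin N, ⋃ i : Fin (4 * N + 1), ⋃ k : Fin (N + 1),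
        {ω | (fun p => X p ω) ∈ formDeviation N j (dyadicParam (-2 + (i : ℕ) / N) k) L})
      ≤ ENNReal.ofReal (N * ((4 * N + 1 : ℕ) * ((N + 1 : ℕ) * (A * (2 * N + 1) * e)))) := by
    have hstep : ∀ (m : ℕ) (S : Fin m → Set Ω) (r : ℝ), (∀ i, P (S i) ≤ ENNReal.ofReal r) →
        P (⋃ i, S i) ≤ ENNReal.ofReal (m * r) := by
      intro m S r hS
      refine (measure_iUnion_fintype_le _ _).trans ((Finset.sum_le_sum fun i _ => hS i).trans ?_)
      rw [Finset.sum_const, Finset.card_univ, Fintype.card_fin, nsmul_eq_mul,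
        ENNReal.ofReal_mul (Nat.cast_nonneg _), ENNReal.ofReal_natCast]
    exact hstep _ _ _ fun j => hstep _ _ _ fun i => hstep _ _ _ fun k => hrow j i k
  refine (add_le_add h1 h2).trans ?_
  rw [← ENNReal.ofReal_add (by positivity) (by positivity)]
  refine ENNReal.ofReal_le_ofReal (le_trans ?_ hunion)
  have he0 : 0 < e := Real.exp_pos _
  have hp1 : (N : ℝ) ≤ N ^ 5 := le_self_pow₀ hN1 (by norm_num)
  have hp2 : (N : ℝ) * ((4 * N + 1) * ((N + 1) * (2 * N + 1))) ≤ 30 * N ^ 5 := by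
    calc (N : ℝ) * ((4 * N + 1) * ((N + 1) * (2 * N + 1)))
        ≤ N * ((4 * N + N) * ((N + N) * (2 * N + N))) := by gcongr
      _ = 30 * N ^ 4 := by ring
      _ ≤ 30 * N ^ 5 := by
          have := pow_le_pow_right₀ hN1 (show 4 ≤ 5 by norm_num)
          linarith
  push_cast
  calc _ = M * e * N + A * e * (N * ((4 * N + 1) * ((N + 1) * (2 * N + 1)))) := by ring
    _ ≤ M * e * N ^ 5 + A * e * (30 * N ^ 5) := by gcongr
    _ = _ := by ring
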